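/- Let $x_1,\dots,x_n\in\mathbb R^d$ with $\|x_i\|=1$ and $y=(y_1,\dots,y_n)\in\mathbb R^n$ with $|y_i|\le B$. Let $$H^\infty_{ij}=\mathbb E_{w\sim N(0,I)}\big[x_i^\top x_j\,\mathbf 1\{w^\top x_i\ge 0,\ w^\top x_j\ge 0\}\big],$$ let $\lambda_0=\lambda_{\min}(H^\infty)$ and assume $\lambda_0>0$; let $\|H^\infty\|$ be the largest eigenvalue of $H^\infty$. Consider the two-layer ReLU network $$f(W,a,x)=\frac1{\sqrt m}\sum_{r=1}^m a_r\max(w_r^\top x,0),$$ initialized with independent $w_r(0)\sim N(0,I)$ and $a_r$ uniform on $\{-1,+1\}$. For $W=(w_1,\dots,w_m)$ put $u_i=f(W,a,x_i)$ and $$\frac{\partial L(W)}{\partial w_r}=\frac{a_r}{\sqrt m}\sum_{i=1}^n (u_i-y_i)\,x_i\,\mathbf 1\{w_r^\top x_i\ge 0\},$$ which is the gradient of the quadratic loss $L(W)=\frac12\sum_i (f(W,a,x_i)-y_i)^2$ (with the derivative of the ReLU at $0$ taken to be $1$). With $a$ fixed and parameters $b_0,\eta,\alpha>0$, AdaLoss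 iterates, for $k=0,1,2,\dots$, $$b_{k+1}^2=b_k^2+\alpha^2\sqrt n\,\|y-u(k)\|,\qquad b_{k+1}>0,\qquad w_r(k+1)=w_r(k)-\frac{\eta}{b_{k+1}}\,\frac{\partial L(W(k))}{\partial w_r},$$ where $u(k)$ is the vector of predictions at $W(k)$ and $\|\cdot\|$ is the Euclidean norm. For every $B$ and every constant $C>1$ there are constants $K_m,K_T>0$ and $p\in\mathbb N$, depending only on $B$ and $C$, such that the following holds for all $n,d,m$, all data as above, all $\delta\in(0,1)$, all $\varepsilon>0$ and all $b_0,\eta,\alpha>0$. Write $\Lambda=1+\log n+\log(1/\lambda_0)+\log(1/\delta)$ and suppose $$m\ \ge\ K_m\left(\frac{n^6}{\lambda_0^4\delta^3}+\frac{\eta^4}{\alpha^4}\cdot\frac{n^4\|H^\infty\|^4}{\lambda_0^4\delta^2}\right).$$ 1. If $b_0/\eta\ge C\|H^\infty\|$, then for every integer $$T\ \ge\ K_T\,\Lambda^p\left(\frac{b_0}{\eta\lambda_0}+\frac{\alpha^2 n}{\eta^2\lambda_0^2\sqrt\delta}\right)\max\{1,\log(1/\varepsilon)\},$$ with probability at least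 $1-\delta$ over the random initialization, $\min_{0\le t\le T}\|y-u(t)\|^2\le\varepsilon$. 2. If $0<b_0/\eta\le C\|H^\infty\|$, then for every integer $$T\ \ge\ K_T\,\Lambda^p\left(\frac{(\eta C\|H^\infty\|)^2-b_0^2}{\alpha^2\sqrt{n\varepsilon}}+\left(\frac{\alpha^2 n}{\eta^2\lambda_0^2\sqrt\delta}+\Big(\frac{\|H^\infty\|}{\lambda_0}\Big)^2\right)\max\{1,\log(1/\varepsilon)\}\right),$$ with probability at least $1-\delta$ over the random initialization, $\min_{0\le t\le T}\|y-u(t)\|^2\le\varepsilon$. -/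

import Mathlib

open MeasureTheory ProbabilityTheory

noncomputable section

namespace AdaLoss

/-- Inputs and weight vectors live in Euclidean space of dimension `d`. -/
abbrev Vec (d : ℕ) : Type := EuclideanSpace ℝ (Fin d)

/-- Smallest eigenvalue of a (symmetric) real matrix. -/
def minEigenvalue {n : ℕ} (A : Matrix (Fin n) (Fin n) ℝ) : ℝ := sInf (spectrum ℝ A)

/-- Largest eigenvalue of a (symmetric) real matrix. -/
def maxEigenvalue {n : ℕ} (A : Matrix (Fin n) (Fin n) ℝ) : ℝ := sSup (spectrum ℝ A)

open Classical in
/-- The infinite-width Gram matrix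
`E_{w ~ N(0, I)} [⟪x i, x j⟫ * 1{⟪w, x i⟫ ≥ 0, ⟪w, x j⟫ ≥ 0}]`. -/
def gramInf {n d : ℕ} (x : Fin n → Vec d) : Matrix (Fin n) (Fin n) ℝ :=
  Matrix.of fun i j =>
    ∫ w, (if 0 ≤ inner ℝ w (x i) ∧ 0 ≤ inner ℝ w (x j) then inner ℝ (x i) (x j) else 0)
      ∂(stdGaussian (Vec d))

/-- Two-layer ReLU network of width `m`, with first layer `W` and output weights `a`. -/
def network {m d : ℕ} (W : Fin m → Vec d) (a : Fin m → ℝ) (x : Vec d) : ℝ :=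
  (1 / Real.sqrt m) * ∑ r, a r * max (inner ℝ (W r) x) 0

/-- Vector of predictions on the data points `x i`. -/
def predictions {n m d : ℕ} (x : Fin n → Vec d) (W : Fin m → Vec d) (a : Fin m → ℝ) :
    EuclideanSpace ℝ (Fin n) :=
  WithLp.toLp 2 fun i => network W a (x i)

open Classical in
/-- Gradient of the loss `(1/2) ∑ i, (network W a (x i) - y i)^2` with respect to the weight
vector `W r`, where the derivative of the ReLU at `0` is taken to be `1`. -/
def lossGrad {n m d : ℕ} (x : Fin n → Vec d) (y : EuclideanSpace ℝ (Fin n))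
    (a : Fin m → ℝ) (W : Fin m → Vec d) (r : Fin m) : Vec d :=
  (a r / Real.sqrt m) •
    ∑ i, (network W a (x i) - y i) • (if 0 ≤ inner ℝ (W r) (x i) then x i else 0)

/-- The iterates `(W(k), b_k)` of AdaLoss started at `(W₀, b₀)`:
`b_{k+1}^2 = b_k^2 + α^2 √n ‖y - u(k)‖` with `b_{k+1} ≥ 0`, and
`W(k+1) = W(k) - (η / b_{k+1}) ∂L(W(k))/∂W`. -/
def iterates {n m d : ℕ} (x : Fin n → Vec d) (y : EuclideanSpace ℝ (Fin n))
    (a : Fin m → ℝ) (b₀ η α : ℝ) (W₀ : Fin m → Vec d) : ℕ → (Fin m → Vec d) × ℝ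
  | 0 => (W₀, b₀)
  | k + 1 =>
    let p := iterates x y a b₀ η α W₀ k
    let b := Real.sqrt (p.2 ^ 2 + α ^ 2 * Real.sqrt n * ‖y - predictions x p.1 a‖)
    (fun r => p.1 r - (η / b) • lossGrad x y a p.1 r, b)

/-- The training residual `‖y - u(k)‖` of AdaLoss at iteration `k`. -/
def residual {n m d : ℕ} (x : Fin n → Vec d) (y : EuclideanSpace ℝ (Fin n))
    (a : Fin m → ℝ) (b₀ η α : ℝ) (W₀ : Fin m → Vec d) (k : ℕ) : ℝ :=
  ‖y - predictions x (iterates x y a b₀ η α W₀ k).1 a‖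

/-- The uniform distribution on `{-1, 1}`. -/
def signMeasure : Measure ℝ :=
  (2⁻¹ : ENNReal) • (Measure.dirac (-1) + Measure.dirac 1)

/-- Random initialization: all first-layer vectors are `N(0, I)`, all output weights are uniform
on `{-1, 1}`, and everything is independent. -/
def initMeasure (m d : ℕ) : Measure ((Fin m → Vec d) × (Fin m → ℝ)) :=
  (Measure.pi fun _ : Fin m => stdGaussian (Vec d)).prod (Measure.pi fun _ : Fin m => signMeasure)

/-- The event that `min_{t ∈ {0, …, T}} ‖y - u(t)‖^2 ≤ ε`. -/
def successEvent {n d : ℕ} (m : ℕ) (x : Fin n → Vec d) (y : EuclideanSpace ℝ (Fin n))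
    (b₀ η α ε : ℝ) (T : ℕ) : Set ((Fin m → Vec d) × (Fin m → ℝ)) :=
  {ω | ∃ t ≤ T, residual x y ω.2 b₀ η α ω.1 t ^ 2 ≤ ε}

/-- The logarithmic factor `1 + log n + log (1/lam) + log (1/δ)`, powers of which are hidden
by the soft-O notation. -/
def logFactor (n : ℕ) (lam δ : ℝ) : ℝ :=
  1 + Real.log n + Real.log (1 / lam) + Real.log (1 / δ)

end AdaLoss

end

/-!
Write `v_k = y - u(k)`, `s_k = η / b_{k+1}`, `λ` and `‖H‖` for the extreme eigenvalues of `H = H^∞`,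
and `R = λ δ / (36 n ^ 2)`.

**Lazy training.** By Markov's inequality, with probability at least `1 - δ` the initial residual is
of order `√(n / δ)`, the Gram matrix at initialization is within `λ / 4` of `H` in Frobenius norm, and
at most `3 n m R / δ` pairs (neuron, data point) have a preactivation of absolute value at most `R`
(`le_initMeasure_of_forall`). As long as every neuron stays within `R` of its initial value, only
those pairs can change their activation, so that `v_{k+1} = v_k - s_k H v_k` up to an error of norm
at most `s_k λ ‖v_k‖ / 2` (`norm_residual_step_le`, `residual_succ_le`). Hence the residual grows at
most by the factor `1 + 2 s_k ‖H‖`, and shrinks by the factor `1 - s_k λ / 2` once `s_k ‖H‖ ≤ 1`.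

**Movement and step size.** Both the movement of a neuron, at most `√(n / m) ∑ s_t ‖v_t‖`, and the
growth of `b` are governed by `∑ s_t ‖v_t‖` (`residual_decay`). While the step size is large, this
sum is at most `2 η (b_k - b_0) / (α ^ 2 √n)` because `b_{k+1} ^ 2 - b_k ^ 2 = α ^ 2 √n ‖v_k‖`. When
the step size is small, it is at most `2 / λ` times the decrease of the residual, which telescopes.
So the movement stays below `R` for the stated width (`movement_le_radius`), `b` stays bounded, and
the residual decays geometrically.

**Iteration count.** If the initial step size is large and the squared residual stays above `ε`, then
`b ^ 2` grows by `α ^ 2 √(n ε)` per step, so the step size is small after `Q` steps, the first term of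
the time threshold. Until then the residual may have grown to order `√(n / δ) + Q √ε`. The logarithm
of `Q`, which may involve `η / α`, enters the number of steps of the geometric decay; it is either
absorbed by `Q` itself or bounded by the logarithmic factor (`mul_log_one_add_le`). One power of the
logarithmic factor suffices.
-/

noncomputable section

namespace AdaLoss

/-! ### Spectral estimates for symmetric matrices -/

open Matrix in
/-- If all the factors `1 - s μ`, for `μ` an eigenvalue of `A`, are at most `c` in absolute value,
then `1 - s A` has operator norm at most `c`. -/
lemma norm_sub_smul_mulVec_le {n : ℕ} {A : Matrix (Fin n) (Fin n) ℝ} (hA : A.IsHermitian)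
    {s c : ℝ} (hc : ∀ i, |1 - s * hA.eigenvalues i| ≤ c) (hc0 : 0 ≤ c)
    (v : EuclideanSpace ℝ (Fin n)) :
    ‖v - s • WithLp.toLp 2 (A *ᵥ v.ofLp)‖ ≤ c * ‖v‖ := by
  have key : ∀ i, inner ℝ (hA.eigenvectorBasis i) (v - s • WithLp.toLp 2 (A *ᵥ v.ofLp))
      = (1 - s * hA.eigenvalues i) * inner ℝ (hA.eigenvectorBasis i) v := by
    intro i
    have h1 : inner ℝ (hA.eigenvectorBasis i) (WithLp.toLp 2 (A *ᵥ v.ofLp))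
        = hA.eigenvalues i * inner ℝ (hA.eigenvectorBasis i) v := by
      have h2 := hA.mulVec_eigenvectorBasis i
      have hT : Aᵀ = A := by rw [← conjTranspose_eq_transpose_of_trivial, hA.eq]
      simp only [PiLp.inner_apply, RCLike.inner_apply, conj_trivial]
      change (A *ᵥ v.ofLp) ⬝ᵥ (hA.eigenvectorBasis i).ofLp
        = _ * (v.ofLp ⬝ᵥ (hA.eigenvectorBasis i).ofLp)
      rw [dotProduct_comm, dotProduct_mulVec, ← mulVec_transpose, hT, h2, smul_dotProduct,
        dotProduct_comm, smul_eq_mul]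
    rw [inner_sub_right, inner_smul_right, h1]; ring
  rw [← abs_of_nonneg (norm_nonneg (v - _)), ← abs_of_nonneg (mul_nonneg hc0 (norm_nonneg v)),
    ← sq_le_sq, mul_pow, ← hA.eigenvectorBasis.sum_sq_norm_inner_right,
    ← hA.eigenvectorBasis.sum_sq_norm_inner_right v, Finset.mul_sum]
  refine Finset.sum_le_sum fun i _ => ?_
  rw [key, norm_mul, mul_pow]
  gcongr
  exact hc i

open Matrix in
/-- The operator norm is at most the Frobenius norm. -/
lemma norm_mulVec_le_sqrt_sum_sq {n : ℕ} (A : Matrix (Fin n) (Fin n) ℝ)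
    (v : EuclideanSpace ℝ (Fin n)) :
    ‖(WithLp.toLp 2 (A *ᵥ v.ofLp) : EuclideanSpace ℝ (Fin n))‖
      ≤ √(∑ i, ∑ j, A i j ^ 2) * ‖v‖ := by
  rw [EuclideanSpace.norm_eq, EuclideanSpace.norm_eq, ← Real.sqrt_mul (by positivity)]
  refine Real.sqrt_le_sqrt ?_
  rw [Finset.sum_mul]
  refine Finset.sum_le_sum fun i _ => ?_
  simp only [Real.norm_eq_abs, sq_abs]
  exact Finset.sum_mul_sq_le_sq_mul_sq Finset.univ (A i) v.ofLp

lemma minEigenvalue_le_eigenvalues {n : ℕ} {A : Matrix (Fin n) (Fin n) ℝ} (hA : A.IsHermitian)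
    (i : Fin n) : minEigenvalue A ≤ hA.eigenvalues i :=
  csInf_le (Matrix.finite_real_spectrum).bddBelow (hA.eigenvalues_mem_spectrum_real i)

lemma eigenvalues_le_maxEigenvalue {n : ℕ} {A : Matrix (Fin n) (Fin n) ℝ} (hA : A.IsHermitian)
    (i : Fin n) : hA.eigenvalues i ≤ maxEigenvalue A :=
  le_csSup (Matrix.finite_real_spectrum).bddAbove (hA.eigenvalues_mem_spectrum_real i)

lemma pos_of_minEigenvalue_pos {n : ℕ} {A : Matrix (Fin n) (Fin n) ℝ}
    (h : 0 < minEigenvalue A) : 0 < n := by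
  rcases Nat.eq_zero_or_pos n with rfl | hn
  · simp [minEigenvalue] at h
  · exact hn

lemma minEigenvalue_le_one {n : ℕ} {A : Matrix (Fin n) (Fin n) ℝ} (hA : A.IsHermitian)
    (hd : ∀ i, A i i ≤ 1) (hpos : 0 < minEigenvalue A) : minEigenvalue A ≤ 1 := by
  have hn : (0 : ℝ) < n := by exact_mod_cast pos_of_minEigenvalue_pos hpos
  have htr : ∑ i, hA.eigenvalues i = ∑ i, A i i := by
    simpa [Matrix.trace] using hA.trace_eq_sum_eigenvalues.symm
  have h1 : ∑ _i : Fin n, minEigenvalue A ≤ ∑ _i : Fin n, (1 : ℝ) :=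
    (Finset.sum_le_sum fun i _ => minEigenvalue_le_eigenvalues hA i).trans
      (htr.le.trans (Finset.sum_le_sum fun i _ => hd i))
  simp only [Finset.sum_const, Finset.card_univ, Fintype.card_fin, nsmul_eq_mul, mul_one] at h1
  nlinarith

lemma minEigenvalue_le_maxEigenvalue {n : ℕ} {A : Matrix (Fin n) (Fin n) ℝ}
    (hA : A.IsHermitian) (hpos : 0 < minEigenvalue A) : minEigenvalue A ≤ maxEigenvalue A :=
  (minEigenvalue_le_eigenvalues hA ⟨0, pos_of_minEigenvalue_pos hpos⟩).trans
    (eigenvalues_le_maxEigenvalue hA _)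

lemma maxEigenvalue_le_card {n : ℕ} {A : Matrix (Fin n) (Fin n) ℝ} (hA : A.IsHermitian)
    (hd : ∀ i, A i i ≤ 1) (hpos : 0 < minEigenvalue A) : maxEigenvalue A ≤ n := by
  have htr : ∑ i, hA.eigenvalues i = ∑ i, A i i := by
    simpa [Matrix.trace] using hA.trace_eq_sum_eigenvalues.symm
  have hsum : ∑ i, hA.eigenvalues i ≤ n := by
    rw [htr]
    exact (Finset.sum_le_sum fun i _ => hd i).trans (by simp)
  rw [maxEigenvalue, hA.spectrum_real_eq_range_eigenvalues]
  have : Nonempty (Fin n) := ⟨⟨0, pos_of_minEigenvalue_pos hpos⟩⟩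
  refine csSup_le (Set.range_nonempty _) ?_
  rintro _ ⟨i, rfl⟩
  refine (Finset.single_le_sum (f := hA.eigenvalues) (fun j _ => ?_) (Finset.mem_univ i)).trans hsum
  exact hpos.le.trans (minEigenvalue_le_eigenvalues hA j)

lemma gramInf_isHermitian {n d : ℕ} (x : Fin n → Vec d) : (gramInf x).IsHermitian := by
  refine Matrix.IsHermitian.ext fun i j => ?_
  simp only [gramInf, Matrix.of_apply, star_trivial, and_comm, real_inner_comm]

lemma gramInf_diag_le_one {n d : ℕ} {x : Fin n → Vec d} (hx : ∀ i, ‖x i‖ = 1) (i : Fin n) :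
    gramInf x i i ≤ 1 := by
  rw [gramInf, Matrix.of_apply]
  refine (integral_mono_of_nonneg (g := fun _ => (1 : ℝ)) (ae_of_all _ fun w => ?_)
    (integrable_const _) (ae_of_all _ fun w => ?_)).trans (by simp)
  · simp only [Pi.zero_apply]; split_ifs <;> simp [hx]
  · dsimp only; split_ifs <;> simp [hx]

/-! ### One gradient step near the initialization -/

open Classical in
/-- The derivative of the ReLU at the preactivation `⟪w, x⟫`, with value `1` at `0`. -/
def activation {d : ℕ} (w x : Vec d) : ℝ := if 0 ≤ inner ℝ w x then 1 else 0

/-- The Gram matrix of the gradient features of a finite network with first layer `W`. -/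
def gramEmp {n m d : ℕ} (x : Fin n → Vec d) (W : Fin m → Vec d) : Matrix (Fin n) (Fin n) ℝ :=
  Matrix.of fun i j =>
    (m : ℝ)⁻¹ * ∑ r, activation (W r) (x i) * activation (W r) (x j) * inner ℝ (x i) (x j)

open Classical in
/-- The number of pairs (neuron, data point) whose preactivation is at most `R` in absolute value.
Only these pairs can change their activation when every neuron moves by at most `R`. -/
def marginCount {n m d : ℕ} (x : Fin n → Vec d) (W : Fin m → Vec d) (R : ℝ) : ℝ :=
  ∑ i, ∑ r, if |inner ℝ (W r) (x i)| ≤ R then 1 else 0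

lemma activation_nonneg {d : ℕ} (w x : Vec d) : 0 ≤ activation w x := by
  unfold activation; split_ifs <;> norm_num

lemma activation_le_one {d : ℕ} (w x : Vec d) : activation w x ≤ 1 := by
  unfold activation; split_ifs <;> norm_num

lemma marginCount_nonneg {n m d : ℕ} (x : Fin n → Vec d) (W : Fin m → Vec d) (R : ℝ) :
    0 ≤ marginCount x W R :=
  Finset.sum_nonneg fun _ _ => Finset.sum_nonneg fun _ _ => by split_ifs <;> norm_num

lemma norm_le_sum_abs {n : ℕ} (v : EuclideanSpace ℝ (Fin n)) : ‖v‖ ≤ ∑ i, |v i| := by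
  rw [EuclideanSpace.norm_eq]
  refine Real.sqrt_le_iff.2 ⟨Finset.sum_nonneg fun _ _ => abs_nonneg _, ?_⟩
  exact Finset.sum_sq_le_sq_sum_of_nonneg fun i _ => abs_nonneg (v i)

lemma sum_abs_le_sqrt_mul_norm {n : ℕ} (v : EuclideanSpace ℝ (Fin n)) :
    ∑ i, |v i| ≤ √n * ‖v‖ := by
  rw [EuclideanSpace.norm_eq, ← Real.sqrt_mul (by positivity)]
  refine Real.le_sqrt_of_sq_le ?_
  simpa using sq_sum_le_card_mul_sum_sq (s := Finset.univ) (f := fun i => |v i|)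

lemma abs_apply_le_norm {n : ℕ} (v : EuclideanSpace ℝ (Fin n)) (i : Fin n) : |v i| ≤ ‖v‖ := by
  simpa using PiLp.norm_apply_le v i

open Classical in
/-- The activation changes only if the margin at the reference point is at most the distance to
it. -/
lemma abs_activation_sub_le {d : ℕ} {w w₀ x : Vec d} {R : ℝ} (hx : ‖x‖ = 1)
    (hw : ‖w - w₀‖ ≤ R) :
    |activation w x - activation w₀ x| ≤ if |inner ℝ w₀ x| ≤ R then 1 else 0 := by
  split_ifs with h
  · rw [abs_le]
    constructor <;> linarith [activation_nonneg w x, activation_le_one w x,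
      activation_nonneg w₀ x, activation_le_one w₀ x]
  · push Not at h
    have h1 : |inner ℝ w x - inner ℝ w₀ x| ≤ R := by
      rw [← inner_sub_left]
      exact (abs_real_inner_le_norm _ _).trans (by rw [hx, mul_one]; exact hw)
    rw [abs_le] at h1
    unfold activation
    rcases lt_abs.1 h with h2 | h2
    · rw [if_pos (by linarith), if_pos (by linarith [(abs_nonneg _).trans (abs_le.2 h1)])]; simp
    · rw [if_neg (by linarith), if_neg (by linarith [(abs_nonneg _).trans (abs_le.2 h1)])]; simp

open Classical in
/-- The ReLU linearized at the reference point is exact unless the margin there is small. -/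
lemma abs_relu_sub_sub_le {d : ℕ} {w w' w₀ x : Vec d} {R : ℝ} (hx : ‖x‖ = 1)
    (hw : ‖w - w₀‖ ≤ R) (hw' : ‖w' - w₀‖ ≤ R) :
    |max (inner ℝ w' x) 0 - max (inner ℝ w x) 0 - activation w₀ x * inner ℝ (w' - w) x|
      ≤ (if |inner ℝ w₀ x| ≤ R then 1 else 0) * ‖w' - w‖ := by
  have hb : ∀ z : Vec d, |inner ℝ z x| ≤ ‖z‖ := fun z => by
    simpa [hx] using abs_real_inner_le_norm z x
  split_ifs with h
  · have h1 := hb (w' - w)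
    rw [inner_sub_left] at h1 ⊢
    rw [one_mul, activation]
    refine le_trans ?_ h1
    rcases max_cases (inner ℝ w' x) 0 with ⟨e1, h1⟩ | ⟨e1, h1⟩ <;>
    rcases max_cases (inner ℝ w x) 0 with ⟨e2, h2⟩ | ⟨e2, h2⟩ <;>
    rw [e1, e2] <;> split_ifs <;>
    rcases abs_cases (inner ℝ w' x - inner ℝ w x) with ⟨e3, h3⟩ | ⟨e3, h3⟩ <;>
    rw [e3, abs_le] <;> constructor <;> linarith
  · push Not at h
    have h1 := (hb (w - w₀)).trans hw
    have h2 := (hb (w' - w₀)).trans hw'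
    have hR := (abs_nonneg _).trans h1
    rw [inner_sub_left, abs_le] at h1 h2
    rw [inner_sub_left, activation]
    rcases lt_abs.1 h with h3 | h3
    · rw [if_pos (by linarith), max_eq_left (by linarith), max_eq_left (by linarith)]; simp
    · rw [if_neg (by linarith), max_eq_right (by linarith), max_eq_right (by linarith)]; simp

lemma norm_lossGrad_le {n m d : ℕ} {x : Fin n → Vec d} (hx : ∀ i, ‖x i‖ = 1)
    (y : EuclideanSpace ℝ (Fin n)) {a : Fin m → ℝ} (ha : ∀ r, |a r| = 1)
    (W : Fin m → Vec d) (r : Fin m) :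
    ‖lossGrad x y a W r‖ ≤ √n / √m * ‖y - predictions x W a‖ := by
  rw [lossGrad, norm_smul, norm_div, Real.norm_eq_abs, ha, Real.norm_eq_abs,
    abs_of_nonneg (Real.sqrt_nonneg _), div_mul_eq_mul_div, div_mul_eq_mul_div, one_mul]
  refine div_le_div_of_nonneg_right ?_ (Real.sqrt_nonneg _)
  refine (norm_sum_le _ _).trans (le_trans ?_ (sum_abs_le_sqrt_mul_norm _))
  refine Finset.sum_le_sum fun i _ => ?_
  rw [norm_smul, Real.norm_eq_abs, abs_sub_comm]
  refine (mul_le_of_le_one_right (abs_nonneg _) ?_).trans_eq rfl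
  split_ifs <;> simp [hx]

/-- The gradient, written with activations and the residual `y - u`. -/
lemma lossGrad_eq {n m d : ℕ} (x : Fin n → Vec d) (y : EuclideanSpace ℝ (Fin n))
    (a : Fin m → ℝ) (W : Fin m → Vec d) (r : Fin m) :
    lossGrad x y a W r = -(a r / √m) •
      ∑ j, ((y - predictions x W a) j * activation (W r) (x j)) • x j := by
  rw [lossGrad, neg_smul, ← smul_neg, ← Finset.sum_neg_distrib]
  congr 1
  refine Finset.sum_congr rfl fun j _ => ?_
  rw [activation, ← neg_smul]
  split_ifs
  · simp [predictions]
  · simp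

/-- While all neurons stay within `R` of their initial values `W₀`, one gradient step with step
size `s` multiplies the residual by `1 - s G` up to a relative error governed by `marginCount`,
where `G` is the Gram matrix at initialization. -/
lemma norm_residual_step_le {n m d : ℕ} {x : Fin n → Vec d} (hx : ∀ i, ‖x i‖ = 1)
    (y : EuclideanSpace ℝ (Fin n)) {a : Fin m → ℝ} (ha : ∀ r, |a r| = 1)
    {W₀ W W' : Fin m → Vec d} {s R : ℝ} (hs : 0 ≤ s)
    (hstep : ∀ r, W' r = W r - s • lossGrad x y a W r)
    (hW : ∀ r, ‖W r - W₀ r‖ ≤ R) (hW' : ∀ r, ‖W' r - W₀ r‖ ≤ R) :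
    ‖(y - predictions x W' a) - ((y - predictions x W a) -
        s • WithLp.toLp 2 (Matrix.mulVec (gramEmp x W₀) (y - predictions x W a).ofLp))‖
      ≤ s * (2 * n / m * marginCount x W₀ R) * ‖y - predictions x W a‖ := by
  classical
  set z := y - predictions x W a with hz
  set χ : Fin m → Fin n → ℝ := fun r i => if |inner ℝ (W₀ r) (x i)| ≤ R then 1 else 0 with hχ
  have hχ0 : ∀ r i, 0 ≤ χ r i := fun r i => by simp only [hχ]; split_ifs <;> norm_num
  have hS : marginCount x W₀ R = ∑ i, ∑ r, χ r i := rfl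
  have hmm : √(m : ℝ) * √m = m := Real.mul_self_sqrt (Nat.cast_nonneg m)
  -- the actual displacement of a neuron, and the one computed with the initial activations
  set Δ : Fin m → Vec d := fun r => W' r - W r with hΔ
  set Δ₀ : Fin m → Vec d :=
    fun r => (s * (a r / √m)) • ∑ j, (z j * activation (W₀ r) (x j)) • x j with hΔ₀
  have hΔeq : ∀ r, Δ r = (s * (a r / √m)) • ∑ j, (z j * activation (W r) (x j)) • x j := by
    intro r
    simp only [hΔ]
    rw [hstep, lossGrad_eq, sub_sub_cancel_left, ← smul_neg, neg_smul, neg_neg, smul_smul]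
  have hΔn : ∀ r, ‖Δ r‖ ≤ s * (√n / √m * ‖z‖) := by
    intro r
    simp only [hΔ]
    rw [hstep, sub_sub_cancel_left, norm_neg, norm_smul, Real.norm_of_nonneg hs]
    exact mul_le_mul_of_nonneg_left (norm_lossGrad_le hx y ha W r) hs
  have hΔd : ∀ r, ‖Δ r - Δ₀ r‖ ≤ s / √m * ∑ j, |z j| * χ r j := by
    intro r
    rw [hΔeq]
    simp only [hΔ₀]
    rw [← smul_sub, ← Finset.sum_sub_distrib, norm_smul, norm_mul, norm_div, Real.norm_of_nonneg hs,
      Real.norm_eq_abs, ha, Real.norm_of_nonneg (Real.sqrt_nonneg _), mul_one_div]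
    refine mul_le_mul_of_nonneg_left ((norm_sum_le _ _).trans ?_) (by positivity)
    refine Finset.sum_le_sum fun j _ => ?_
    rw [← sub_smul, ← mul_sub, norm_smul, hx, mul_one, norm_mul, Real.norm_eq_abs, Real.norm_eq_abs]
    exact mul_le_mul_of_nonneg_left (abs_activation_sub_le (hx j) (hW r)) (abs_nonneg _)
  have hgram : ∀ i, s * Matrix.mulVec (gramEmp x W₀) z.ofLp i
      = (√m)⁻¹ * ∑ r, a r * (activation (W₀ r) (x i) * inner ℝ (Δ₀ r) (x i)) := by
    intro i
    simp only [Matrix.mulVec, dotProduct, gramEmp, Matrix.of_apply, hΔ₀, inner_smul_left, sum_inner,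
      conj_trivial, Finset.mul_sum, Finset.sum_mul]
    rw [Finset.sum_comm]
    refine Finset.sum_congr rfl fun r _ => Finset.sum_congr rfl fun j _ => ?_
    have hr : a r * a r = 1 := by rw [← abs_mul_abs_self, ha, one_mul]
    have e : (m : ℝ)⁻¹ = (√m)⁻¹ * (√m)⁻¹ := by rw [← mul_inv, hmm]
    rw [e, real_inner_comm (x j) (x i), div_eq_mul_inv]
    linear_combination (-(s * (√m)⁻¹ * (√m)⁻¹ * activation (W₀ r) (x i) * activation (W₀ r) (x j)
      * inner ℝ (x j) (x i) * z j)) * hr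
  have hcoord : ∀ i, |((y - predictions x W' a) - (z -
        s • WithLp.toLp 2 (Matrix.mulVec (gramEmp x W₀) z.ofLp))) i|
      ≤ s / m * ‖z‖ * (√n * (∑ r, χ r i) + marginCount x W₀ R) := by
    intro i
    have e1 : ((y - predictions x W' a) - (z -
        s • WithLp.toLp 2 (Matrix.mulVec (gramEmp x W₀) z.ofLp))) i
        = -((√m)⁻¹ * ∑ r, a r * ((max (inner ℝ (W' r) (x i)) 0 - max (inner ℝ (W r) (x i)) 0
            - activation (W₀ r) (x i) * inner ℝ (Δ r) (x i))
            + activation (W₀ r) (x i) * inner ℝ (Δ r - Δ₀ r) (x i))) := by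
      have : ((y - predictions x W' a) - (z -
        s • WithLp.toLp 2 (Matrix.mulVec (gramEmp x W₀) z.ofLp))) i
        = -(network W' a (x i) - network W a (x i)) + s * Matrix.mulVec (gramEmp x W₀) z.ofLp i := by
        simp only [hz, predictions, PiLp.sub_apply, PiLp.smul_apply, smul_eq_mul]
        ring
      rw [this, hgram, network, network, one_div, ← mul_sub, ← Finset.sum_sub_distrib, ← mul_neg,
        ← mul_neg, ← mul_add, ← Finset.sum_neg_distrib, ← Finset.sum_neg_distrib,
        ← Finset.sum_add_distrib]
      congr 1
      refine Finset.sum_congr rfl fun r _ => ?_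
      rw [inner_sub_left (Δ r)]
      ring
    rw [e1, abs_neg, abs_mul, abs_of_nonneg (inv_nonneg.2 (Real.sqrt_nonneg _))]
    have e2 : ∀ r, |a r * ((max (inner ℝ (W' r) (x i)) 0 - max (inner ℝ (W r) (x i)) 0
            - activation (W₀ r) (x i) * inner ℝ (Δ r) (x i))
            + activation (W₀ r) (x i) * inner ℝ (Δ r - Δ₀ r) (x i))|
          ≤ χ r i * (s * (√n / √m * ‖z‖)) + s / √m * ∑ j, ‖z‖ * χ r j := by
      intro r
      rw [abs_mul, ha, one_mul]
      refine (abs_add_le _ _).trans (add_le_add ?_ ?_)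
      · exact (abs_relu_sub_sub_le (hx i) (hW r) (hW' r)).trans
          (mul_le_mul_of_nonneg_left (hΔn r) (hχ0 r i))
      · rw [abs_mul, abs_of_nonneg (activation_nonneg _ _)]
        refine (mul_le_of_le_one_left (abs_nonneg _) (activation_le_one _ _)).trans ?_
        refine (abs_real_inner_le_norm _ _).trans ?_
        rw [hx, mul_one]
        refine (hΔd r).trans (mul_le_mul_of_nonneg_left (Finset.sum_le_sum fun j _ => ?_)
          (by positivity))
        exact mul_le_mul_of_nonneg_right (abs_apply_le_norm z j) (hχ0 r j)
    refine (mul_le_mul_of_nonneg_left ((Finset.abs_sum_le_sum_abs _ _).trans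
      (Finset.sum_le_sum fun r _ => e2 r)) (inv_nonneg.2 (Real.sqrt_nonneg _))).trans_eq ?_
    rw [Finset.sum_add_distrib, ← Finset.sum_mul, ← Finset.mul_sum, Finset.sum_comm, hS]
    simp only [← Finset.mul_sum]
    have e : (m : ℝ)⁻¹ = (√m)⁻¹ * (√m)⁻¹ := by rw [← mul_inv, hmm]
    rw [div_eq_mul_inv s (m : ℝ), e]
    simp only [div_eq_mul_inv]
    ring
  refine (norm_le_sum_abs _).trans ((Finset.sum_le_sum fun i _ => hcoord i).trans ?_)
  rw [← Finset.mul_sum, Finset.sum_add_distrib, ← Finset.mul_sum, ← hS]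
  have hn : √(n : ℝ) ≤ n := by
    rcases Nat.eq_zero_or_pos n with rfl | h
    · simp
    · exact Real.sqrt_le_left (by positivity) |>.2 (by
        have : (1 : ℝ) ≤ n := by exact_mod_cast h
        nlinarith)
  have h2 := mul_le_mul_of_nonneg_right hn (marginCount_nonneg x W₀ R)
  simp only [Finset.sum_const, Finset.card_univ, Fintype.card_fin, nsmul_eq_mul]
  calc s / m * ‖z‖ * (√n * marginCount x W₀ R + n * marginCount x W₀ R)
      ≤ s / m * ‖z‖ * (n * marginCount x W₀ R + n * marginCount x W₀ R) := by gcongr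
    _ = _ := by ring

/-! ### The coupled recursion of residual norms and adaptive step sizes -/

/-- While `b` grows, the total movement is controlled by the growth of `b` alone. -/
lemma sum_step_mul_le {r b : ℕ → ℝ} {β η : ℝ} (hβ : 0 < β) (hη : 0 < η)
    (hr : ∀ k, 0 ≤ r k) (hb : ∀ k, 0 < b k) (hrec : ∀ k, b (k + 1) ^ 2 = b k ^ 2 + β * r k)
    (k : ℕ) : ∑ t ∈ Finset.range k, η / b (t + 1) * r t ≤ 2 * η * (b k - b 0) / β := by
  induction k with
  | zero => simp
  | succ k ih =>
    rw [Finset.sum_range_succ]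
    have hle : b k ≤ b (k + 1) := by
      refine (sq_le_sq₀ (hb _).le (hb _).le).1 ?_
      nlinarith [mul_nonneg hβ.le (hr k), hrec k]
    have h1 : η / b (k + 1) * r k ≤ 2 * η * (b (k + 1) - b k) / β := by
      rw [div_mul_eq_mul_div, div_le_div_iff₀ (hb _) hβ]
      have : β * r k = (b (k + 1) - b k) * (b (k + 1) + b k) := by linear_combination -hrec k
      have h2 : (b (k + 1) - b k) * (b (k + 1) + b k) ≤ (b (k + 1) - b k) * (2 * b (k + 1)) :=
        mul_le_mul_of_nonneg_left (by linarith) (by linarith)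
      calc η * r k * β = η * (β * r k) := by ring
        _ ≤ η * ((b (k + 1) - b k) * (2 * b (k + 1))) := by
            rw [this]; exact mul_le_mul_of_nonneg_left h2 hη.le
        _ = _ := by ring
    calc _ ≤ 2 * η * (b k - b 0) / β + 2 * η * (b (k + 1) - b k) / β := add_le_add ih h1
      _ = _ := by ring

/-- Suppose that, as long as the total movement `∑ q s_t r_t` stays below `R`, the residual `r`
grows at most by the factor `1 + 2 H s_k`, and shrinks by the factor `1 - s_k λ / 2` once
`s_k H ≤ 1`, where `s_k = η / b_{k+1}`. If the step size is small from step `T₀` on, the total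
movement up to `T₀` and the contraction thereafter keep the iteration within the radius `R`, the
sequence `b` stays bounded, and the residual decays geometrically. -/
lemma residual_decay {r b : ℕ → ℝ} {β η q R lam H ρ₀ ρ P : ℝ} {T₀ : ℕ}
    (hβ : 0 < β) (hη : 0 < η) (hq : 0 ≤ q) (hlam : 0 < lam) (hH : lam ≤ H)
    (hr : ∀ k, 0 ≤ r k) (hb : ∀ k, 0 < b k) (hrec : ∀ k, b (k + 1) ^ 2 = b k ^ 2 + β * r k)
    (hgrow : ∀ k, ∑ t ∈ Finset.range (k + 1), q * (η / b (t + 1) * r t) ≤ R →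
      r (k + 1) ≤ (1 + 2 * H * (η / b (k + 1))) * r k)
    (hshrink : ∀ k, ∑ t ∈ Finset.range (k + 1), q * (η / b (t + 1) * r t) ≤ R →
      η / b (k + 1) * H ≤ 1 → r (k + 1) ≤ (1 - η / b (k + 1) * lam / 2) * r k)
    (hT₀ : η * H ≤ b (T₀ + 1)) (hr0 : r 0 ≤ ρ₀)
    (hP : 2 * η * (b T₀ - b 0) / β ≤ P) (hρ : ρ₀ + 2 * H * P ≤ ρ)
    (hR : q * (P + 2 * ρ / lam) ≤ R) (k : ℕ) :
    0 ≤ 1 - η * lam / (2 * (b T₀ + 2 * β * ρ / (η * lam))) ∧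
      r (T₀ + k) ≤ (1 - η * lam / (2 * (b T₀ + 2 * β * ρ / (η * lam)))) ^ k * ρ := by
  have hH0 : 0 < H := hlam.trans_le hH
  have hs : ∀ k, 0 < η / b (k + 1) := fun k => div_pos hη (hb _)
  have hmono : Monotone b := monotone_nat_of_le_succ fun k => by
    refine (sq_le_sq₀ (hb _).le (hb _).le).1 ?_
    nlinarith [mul_nonneg hβ.le (hr k), hrec k]
  set M : ℕ → ℝ := fun k => ∑ t ∈ Finset.range k, η / b (t + 1) * r t with hM
  have hMs : ∀ k, M (k + 1) = M k + η / b (k + 1) * r k := fun k => by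
    simp only [hM]; rw [Finset.sum_range_succ]
  have hMm : Monotone M := monotone_nat_of_le_succ fun k => by
    rw [hMs]; linarith [mul_nonneg (hs k).le (hr k)]
  have hqs : ∀ k, ∑ t ∈ Finset.range k, q * (η / b (t + 1) * r t) = q * M k := fun k => by
    simp only [hM]; rw [Finset.mul_sum]
  simp only [hqs] at hgrow hshrink
  have hMT : M T₀ ≤ P := (sum_step_mul_le hβ hη hr hb hrec T₀).trans hP
  have hM0 : M 0 = 0 := by simp [hM]
  have hP0 : 0 ≤ P := by linarith [hMm (Nat.zero_le T₀)]
  have hρ0 : 0 ≤ ρ := by nlinarith [hr 0, mul_nonneg hH0.le hP0]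
  have hqP : q * P ≤ R := by
    refine le_trans (mul_le_mul_of_nonneg_left ?_ hq) hR
    have : 0 ≤ 2 * ρ / lam := by positivity
    linarith
  -- up to `T₀`, the residual grows at most additively, by `2 H` times the movement
  have hphase1 : ∀ k ≤ T₀, r k ≤ ρ₀ + 2 * H * M k := by
    intro k
    induction k with
    | zero => intro _; rw [hM0]; linarith
    | succ k ih =>
      intro hk
      have h1 := hgrow k ((mul_le_mul_of_nonneg_left ((hMm hk).trans hMT) hq).trans hqP)
      have h2 := ih (by omega)
      rw [hMs]
      linarith
  have hrT : r T₀ ≤ ρ := by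
    have := mul_le_mul_of_nonneg_left hMT hH0.le
    linarith [hphase1 T₀ le_rfl]
  have hsmall : ∀ k, η / b (T₀ + k + 1) * H ≤ 1 := fun k => by
    rw [div_mul_eq_mul_div, div_le_one (hb _)]
    exact hT₀.trans (hmono (by omega))
  -- from `T₀` on, the movement is bounded by the decrease of the residual
  have hphase2 : ∀ k, M (T₀ + k) ≤ P + 2 / lam * (ρ - r (T₀ + k)) := by
    intro k
    induction k with
    | zero =>
      have : 0 ≤ 2 / lam * (ρ - r (T₀ + 0)) := mul_nonneg (by positivity) (by simpa using hrT)
      simpa using hMT.trans (by simpa using this)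
    | succ k ih =>
      have hlast : η / b (T₀ + k + 1) * r (T₀ + k) ≤ 2 / lam * r (T₀ + k) := by
        refine mul_le_mul_of_nonneg_right ?_ (hr _)
        rw [le_div_iff₀ hlam]
        nlinarith [hsmall k, mul_le_mul_of_nonneg_left hH (hs (T₀ + k)).le]
      have hin : q * M (T₀ + k + 1) ≤ R := by
        refine le_trans (mul_le_mul_of_nonneg_left ?_ hq) hR
        rw [hMs]
        calc _ ≤ P + 2 / lam * (ρ - r (T₀ + k)) + 2 / lam * r (T₀ + k) := add_le_add ih hlast
          _ = _ := by ring
      have h1 := hshrink (T₀ + k) hin (hsmall k)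
      rw [← add_assoc, hMs]
      have h2 : η / b (T₀ + k + 1) * r (T₀ + k)
          ≤ 2 / lam * (r (T₀ + k) - r (T₀ + k + 1)) := by
        rw [div_mul_eq_mul_div 2, le_div_iff₀ hlam]
        linarith
      calc _ ≤ P + 2 / lam * (ρ - r (T₀ + k)) + 2 / lam * (r (T₀ + k) - r (T₀ + k + 1)) :=
            add_le_add ih h2
        _ = _ := by ring
  have hin : ∀ k, q * M (T₀ + k) ≤ R := fun k => by
    refine le_trans (mul_le_mul_of_nonneg_left ((hphase2 k).trans ?_) hq) hR
    have : 2 / lam * (ρ - r (T₀ + k)) ≤ 2 / lam * ρ :=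
      mul_le_mul_of_nonneg_left (by linarith [hr (T₀ + k)]) (by positivity)
    calc _ ≤ P + 2 / lam * ρ := by linarith
      _ = _ := by ring
  have hstep : ∀ k, r (T₀ + k + 1) ≤ (1 - η / b (T₀ + k + 1) * lam / 2) * r (T₀ + k) :=
    fun k => hshrink _ (by simpa [add_assoc] using hin (k + 1)) (hsmall k)
  -- `b (k + 1) - b k ≤ β r k / b (k + 1)`, which telescopes with the decrease of the residual
  have hbbd : ∀ k, b (T₀ + k) ≤ b T₀ + 2 * β / (η * lam) * (ρ - r (T₀ + k)) := by
    intro k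
    induction k with
    | zero =>
      have : 0 ≤ 2 * β / (η * lam) * (ρ - r (T₀ + 0)) :=
        mul_nonneg (by positivity) (by simpa using hrT)
      simpa using this
    | succ k ih =>
      have h1 := hstep k
      have h2 : b (T₀ + k + 1) - b (T₀ + k) ≤ β / η * (η / b (T₀ + k + 1) * r (T₀ + k)) := by
        have e : β / η * (η / b (T₀ + k + 1) * r (T₀ + k)) = β * r (T₀ + k) / b (T₀ + k + 1) := by
          field_simp
        rw [e, le_div_iff₀ (hb _)]
        have : β * r (T₀ + k) = (b (T₀ + k + 1) - b (T₀ + k)) * (b (T₀ + k + 1) + b (T₀ + k)) := by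
          linear_combination -hrec (T₀ + k)
        rw [this]
        exact mul_le_mul_of_nonneg_left (by linarith [hb (T₀ + k)])
          (sub_nonneg.2 (hmono (Nat.le_succ _)))
      have h3 : η / b (T₀ + k + 1) * r (T₀ + k)
          ≤ 2 / lam * (r (T₀ + k) - r (T₀ + k + 1)) := by
        rw [div_mul_eq_mul_div 2, le_div_iff₀ hlam]
        linarith
      have h4 := h2.trans (mul_le_mul_of_nonneg_left h3 (by positivity))
      rw [← add_assoc]
      calc b (T₀ + k + 1) ≤ b T₀ + 2 * β / (η * lam) * (ρ - r (T₀ + k))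
            + β / η * (2 / lam * (r (T₀ + k) - r (T₀ + k + 1))) := by linarith
        _ = _ := by field_simp; ring
  set binf := b T₀ + 2 * β * ρ / (η * lam) with hbinf
  have hbinf_pos : 0 < binf := add_pos_of_pos_of_nonneg (hb _) (by positivity)
  have hble : ∀ k, b (T₀ + k) ≤ binf := fun k => by
    refine (hbbd k).trans ?_
    have : 2 * β / (η * lam) * (ρ - r (T₀ + k)) ≤ 2 * β / (η * lam) * ρ :=
      mul_le_mul_of_nonneg_left (by linarith [hr (T₀ + k)]) (by positivity)
    calc _ ≤ b T₀ + 2 * β / (η * lam) * ρ := by linarith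
      _ = _ := by rw [hbinf]; ring
  have hfac : ∀ k, 1 - η / b (T₀ + k + 1) * lam / 2 ≤ 1 - η * lam / (2 * binf) := fun k => by
    have : η * lam / (2 * binf) ≤ η * lam / (2 * b (T₀ + k + 1)) :=
      div_le_div_of_nonneg_left (by positivity) (mul_pos two_pos (hb _))
        (mul_le_mul_of_nonneg_left (hble (k + 1)) two_pos.le)
    have e : η / b (T₀ + k + 1) * lam / 2 = η * lam / (2 * b (T₀ + k + 1)) := by
      have := (hb (T₀ + k + 1)).ne'
      field_simp
    linarith
  have hfac0 : 0 ≤ 1 - η * lam / (2 * binf) := by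
    refine le_trans ?_ (hfac 0)
    nlinarith [hsmall 0, mul_le_mul_of_nonneg_left hH (hs (T₀ + 0)).le]
  refine ⟨hfac0, ?_⟩
  induction k with
  | zero => simpa using hrT
  | succ k ih =>
    rw [← add_assoc, pow_succ']
    calc r (T₀ + k + 1) ≤ (1 - η / b (T₀ + k + 1) * lam / 2) * r (T₀ + k) := hstep k
      _ ≤ (1 - η * lam / (2 * binf)) * r (T₀ + k) := mul_le_mul_of_nonneg_right (hfac k) (hr _)
      _ ≤ (1 - η * lam / (2 * binf)) * ((1 - η * lam / (2 * binf)) ^ k * ρ) :=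
          mul_le_mul_of_nonneg_left ih hfac0
      _ = _ := by ring

/-- Geometric decay at rate `1 - η λ / (2 b)` brings the squared residual below `ε` after
`b / (η λ) * log (ρ ^ 2 / ε)` steps. -/
lemma sq_geometric_le {ρ ε c : ℝ} {k : ℕ} (hρ : 0 < ρ) (hε : 0 < ε) (hc : 0 < c)
    (hc1 : c ≤ 2) (hk : Real.log (ρ ^ 2 / ε) / c ≤ k) :
    ((1 - c / 2) ^ k * ρ) ^ 2 ≤ ε := by
  have h1 : (1 - c / 2) ^ k ≤ Real.exp (-(c * k / 2)) := by
    have : (1 - c / 2) ≤ Real.exp (-(c / 2)) := by linarith [Real.add_one_le_exp (-(c / 2))]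
    calc _ ≤ (Real.exp (-(c / 2))) ^ k := pow_le_pow_left₀ (by linarith) this k
      _ = _ := by rw [← Real.exp_nat_mul]; congr 1; ring
  have h0 : 0 ≤ (1 - c / 2) ^ k := pow_nonneg (by linarith) _
  rw [div_le_iff₀ hc] at hk
  calc ((1 - c / 2) ^ k * ρ) ^ 2 ≤ (Real.exp (-(c * k / 2)) * ρ) ^ 2 := by gcongr
    _ = Real.exp (-(k * c)) * ρ ^ 2 := by
        rw [mul_pow, ← Real.exp_nat_mul]; congr 2; push_cast; ring
    _ ≤ Real.exp (-Real.log (ρ ^ 2 / ε)) * ρ ^ 2 := by gcongr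
    _ = ε := by
        rw [Real.exp_neg, Real.exp_log (by positivity)]; field_simp

/-! ### Convergence from a favourable initialization -/

section Iterates

variable {n m d : ℕ} (x : Fin n → Vec d) (y : EuclideanSpace ℝ (Fin n)) (a : Fin m → ℝ)
  (b₀ η α : ℝ) (W₀ : Fin m → Vec d)

lemma iterates_snd_sq (k : ℕ) :
    (iterates x y a b₀ η α W₀ (k + 1)).2 ^ 2
      = (iterates x y a b₀ η α W₀ k).2 ^ 2 + α ^ 2 * √n * residual x y a b₀ η α W₀ k := by
  simp only [iterates, residual]
  exact Real.sq_sqrt (by positivity)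

lemma iterates_snd_pos (hb₀ : 0 < b₀) (k : ℕ) : 0 < (iterates x y a b₀ η α W₀ k).2 := by
  induction k with
  | zero => exact hb₀
  | succ k ih =>
    simp only [iterates]
    exact Real.sqrt_pos.2 (by positivity)

lemma iterates_fst_succ (k : ℕ) (r : Fin m) :
    (iterates x y a b₀ η α W₀ (k + 1)).1 r = (iterates x y a b₀ η α W₀ k).1 r
      - (η / (iterates x y a b₀ η α W₀ (k + 1)).2) •
        lossGrad x y a (iterates x y a b₀ η α W₀ k).1 r := rfl

variable {x y a b₀ η α W₀}

/-- Every neuron moves by at most the accumulated `√(n / m) * s_t * ‖y - u(t)‖`. -/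
lemma norm_iterates_sub_le (hx : ∀ i, ‖x i‖ = 1) (ha : ∀ r, |a r| = 1) (hb₀ : 0 < b₀)
    (hη : 0 < η) (k : ℕ) (r : Fin m) :
    ‖(iterates x y a b₀ η α W₀ k).1 r - W₀ r‖ ≤ ∑ t ∈ Finset.range k,
      √n / √m * (η / (iterates x y a b₀ η α W₀ (t + 1)).2 * residual x y a b₀ η α W₀ t) := by
  induction k with
  | zero => simp [iterates]
  | succ k ih =>
    rw [Finset.sum_range_succ, iterates_fst_succ, sub_right_comm]
    refine (norm_sub_le _ _).trans (add_le_add ih ?_)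
    have hs := div_pos hη (iterates_snd_pos x y a b₀ η α W₀ hb₀ (k + 1))
    rw [norm_smul, Real.norm_of_nonneg hs.le]
    calc _ ≤ η / (iterates x y a b₀ η α W₀ (k + 1)).2 *
          (√n / √m * residual x y a b₀ η α W₀ k) :=
          mul_le_mul_of_nonneg_left (norm_lossGrad_le hx y ha _ r) hs.le
      _ = _ := by ring

/-- The one-step bound with the infinite-width Gram matrix in place of the one at
initialization. -/
lemma residual_succ_le {R c : ℝ} (hx : ∀ i, ‖x i‖ = 1) (ha : ∀ r, |a r| = 1) (hb₀ : 0 < b₀)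
    (hη : 0 < η) (hlam : 0 < minEigenvalue (gramInf x))
    (hgram : ∑ i, ∑ j, (gramEmp x W₀ i j - gramInf x i j) ^ 2 ≤ minEigenvalue (gramInf x) ^ 2 / 16)
    (hmargin : 2 * n / m * marginCount x W₀ R ≤ minEigenvalue (gramInf x) / 4) (k : ℕ)
    (hin : ∑ t ∈ Finset.range (k + 1), √n / √m *
      (η / (iterates x y a b₀ η α W₀ (t + 1)).2 * residual x y a b₀ η α W₀ t) ≤ R)
    (hc0 : 0 ≤ c)
    (hc : ∀ i, |1 - η / (iterates x y a b₀ η α W₀ (k + 1)).2 *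
      (gramInf_isHermitian x).eigenvalues i| ≤ c) :
    residual x y a b₀ η α W₀ (k + 1) ≤
      (c + η / (iterates x y a b₀ η α W₀ (k + 1)).2 * minEigenvalue (gramInf x) / 2)
        * residual x y a b₀ η α W₀ k := by
  set s := η / (iterates x y a b₀ η α W₀ (k + 1)).2 with hs
  set lam := minEigenvalue (gramInf x)
  have hspos : 0 < s := div_pos hη (iterates_snd_pos x y a b₀ η α W₀ hb₀ (k + 1))
  have hin' : ∑ t ∈ Finset.range k, √n / √m *
      (η / (iterates x y a b₀ η α W₀ (t + 1)).2 * residual x y a b₀ η α W₀ t) ≤ R := by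
    refine le_trans ?_ hin
    rw [Finset.sum_range_succ]
    exact le_add_of_nonneg_right (mul_nonneg (by positivity) (mul_nonneg hspos.le (norm_nonneg _)))
  have h := norm_residual_step_le (W₀ := W₀) hx y ha hspos.le
    (iterates_fst_succ x y a b₀ η α W₀ k)
    (fun r => (norm_iterates_sub_le hx ha hb₀ hη k r).trans hin')
    (fun r => (norm_iterates_sub_le hx ha hb₀ hη (k + 1) r).trans hin)
  have hres : residual x y a b₀ η α W₀ k
    = ‖y - predictions x (iterates x y a b₀ η α W₀ k).1 a‖ := rfl
  rw [residual, hres]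
  set v := y - predictions x (iterates x y a b₀ η α W₀ k).1 a with hv
  set v' := y - predictions x (iterates x y a b₀ η α W₀ (k + 1)).1 a with hv'
  have h1 := norm_sub_smul_mulVec_le (gramInf_isHermitian x) hc hc0 v
  have h2 := norm_mulVec_le_sqrt_sum_sq (gramEmp x W₀ - gramInf x) v
  have h3 : √(∑ i, ∑ j, (gramEmp x W₀ - gramInf x) i j ^ 2) ≤ lam / 4 := by
    refine Real.sqrt_le_iff.2 ⟨by positivity, hgram.trans_eq (by ring)⟩
  have e : v' = (v' - (v - s • WithLp.toLp 2 (Matrix.mulVec (gramEmp x W₀) v.ofLp)))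
      + ((v - s • WithLp.toLp 2 (Matrix.mulVec (gramInf x) v.ofLp))
      - s • WithLp.toLp 2 (Matrix.mulVec (gramEmp x W₀ - gramInf x) v.ofLp)) := by
    rw [Matrix.sub_mulVec, WithLp.toLp_sub, smul_sub]; abel
  rw [e]
  refine (norm_add_le _ _).trans ((add_le_add h (norm_sub_le _ _)).trans ?_)
  rw [norm_smul, Real.norm_of_nonneg hspos.le]
  have h4 : s * (2 * n / m * marginCount x W₀ R) * ‖v‖ ≤ s * (lam / 4) * ‖v‖ := by gcongr
  have h5 : s * ‖(WithLp.toLp 2 (Matrix.mulVec (gramEmp x W₀ - gramInf x) v.ofLp) :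
      EuclideanSpace ℝ (Fin n))‖ ≤ s * (lam / 4 * ‖v‖) := by
    refine mul_le_mul_of_nonneg_left (h2.trans ?_) hspos.le
    gcongr
  linarith

/-- Deterministic convergence. `hgram`, `hmargin` and `hρ₀` describe a favourable initialization;
`T₀` is an iteration after which the step size is below `1 / ‖H‖`, and `P` bounds the movement
before it. -/
lemma exists_residual_sq_le {R ρ₀ ρ P ε : ℝ} {T₀ k : ℕ} (hx : ∀ i, ‖x i‖ = 1)
    (ha : ∀ r, |a r| = 1) (hb₀ : 0 < b₀) (hη : 0 < η) (hα : 0 < α) (hε : 0 < ε)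
    (hlam : 0 < minEigenvalue (gramInf x))
    (hgram : ∑ i, ∑ j, (gramEmp x W₀ i j - gramInf x i j) ^ 2 ≤ minEigenvalue (gramInf x) ^ 2 / 16)
    (hmargin : 2 * n / m * marginCount x W₀ R ≤ minEigenvalue (gramInf x) / 4)
    (hρ₀ : residual x y a b₀ η α W₀ 0 ≤ ρ₀) (hρpos : 0 < ρ)
    (hT₀ : η * maxEigenvalue (gramInf x) ≤ (iterates x y a b₀ η α W₀ (T₀ + 1)).2)
    (hP : 2 * η * ((iterates x y a b₀ η α W₀ T₀).2 - b₀) / (α ^ 2 * √n) ≤ P)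
    (hρ : ρ₀ + 2 * maxEigenvalue (gramInf x) * P ≤ ρ)
    (hR : √n / √m * (P + 2 * ρ / minEigenvalue (gramInf x)) ≤ R)
    (hk : ((iterates x y a b₀ η α W₀ T₀).2 + 2 * (α ^ 2 * √n) * ρ / (η * minEigenvalue (gramInf x)))
      / (η * minEigenvalue (gramInf x)) * Real.log (ρ ^ 2 / ε) ≤ k) :
    residual x y a b₀ η α W₀ (T₀ + k) ^ 2 ≤ ε := by
  have hn : (0 : ℝ) < n := by exact_mod_cast pos_of_minEigenvalue_pos hlam
  have hA := gramInf_isHermitian x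
  have hH := minEigenvalue_le_maxEigenvalue hA hlam
  have hbp := iterates_snd_pos x y a b₀ η α W₀ hb₀
  have hβ : 0 < α ^ 2 * √n := by positivity
  have hrec := iterates_snd_sq x y a b₀ η α W₀
  have hsp : ∀ k, 0 < η / (iterates x y a b₀ η α W₀ (k + 1)).2 := fun k => div_pos hη (hbp _)
  have hH0 := hlam.trans_le hH
  obtain ⟨hfac, hdecay⟩ := residual_decay (r := residual x y a b₀ η α W₀)
    (b := fun k => (iterates x y a b₀ η α W₀ k).2) (q := √n / √m) (R := R) hβ hη
    (by positivity) hlam hH (fun _ => norm_nonneg _) hbp hrec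
    (fun k hin => by
      have := residual_succ_le (c := 1 + η / (iterates x y a b₀ η α W₀ (k + 1)).2 *
        maxEigenvalue (gramInf x)) hx ha hb₀ hη hlam hgram hmargin k hin
        (by have := mul_pos (hsp k) hH0; linarith)
        (fun i => by
          have h1 := mul_le_mul_of_nonneg_left (eigenvalues_le_maxEigenvalue hA i) (hsp k).le
          have h2 := mul_pos (hsp k) (hlam.trans_le (minEigenvalue_le_eigenvalues hA i))
          rw [abs_le]; constructor <;> linarith)
      refine this.trans (mul_le_mul_of_nonneg_right ?_ (norm_nonneg _))
      have h3 := mul_le_mul_of_nonneg_left hH (hsp k).le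
      have h4 := mul_pos (hsp k) hlam
      linarith)
    (fun k hin hs1 => by
      have h0 := mul_le_mul_of_nonneg_left hH (hsp k).le
      have := residual_succ_le (c := 1 - η / (iterates x y a b₀ η α W₀ (k + 1)).2 *
        minEigenvalue (gramInf x)) hx ha hb₀ hη hlam hgram hmargin k hin
        (by linarith)
        (fun i => by
          have h1 := mul_le_mul_of_nonneg_left (eigenvalues_le_maxEigenvalue hA i) (hsp k).le
          have h2 := mul_le_mul_of_nonneg_left (minEigenvalue_le_eigenvalues hA i) (hsp k).le
          rw [abs_le]; constructor <;> linarith)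
      refine this.trans_eq ?_
      ring)
    hT₀ hρ₀ hP hρ hR k
  set binf := (iterates x y a b₀ η α W₀ T₀).2
    + 2 * (α ^ 2 * √n) * ρ / (η * minEigenvalue (gramInf x)) with hbinf
  have hx0 : 0 < 2 * (α ^ 2 * √n) * ρ / (η * minEigenvalue (gramInf x)) := by positivity
  have hbinf_pos : 0 < binf := add_pos (hbp _) hx0
  have hc1 : η * minEigenvalue (gramInf x) / binf ≤ 2 := by
    have e : η * minEigenvalue (gramInf x) / binf
      = 2 * (η * minEigenvalue (gramInf x) / (2 * binf)) := by field_simp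
    rw [e]
    linarith
  have h1 : (1 - η * minEigenvalue (gramInf x) / (2 * binf))
      = 1 - η * minEigenvalue (gramInf x) / binf / 2 := by rw [div_div, mul_comm binf]
  rw [h1] at hdecay
  refine le_trans (pow_le_pow_left₀ (norm_nonneg _) hdecay 2) ?_
  refine sq_geometric_le hρpos hε (by positivity) hc1 ?_
  refine le_trans (le_of_eq ?_) hk
  field_simp

end Iterates

/-! ### Moments of the random initialization -/

lemma map_inner_stdGaussian {d : ℕ} {x : Vec d} (hx : ‖x‖ = 1) :
    (stdGaussian (Vec d)).map (fun w => inner ℝ w x) = gaussianReal 0 1 := by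
  have h := IsGaussian.map_eq_gaussianReal (μ := stdGaussian (Vec d)) (innerSL ℝ x)
  rw [integral_strongDual_stdGaussian, variance_dual_stdGaussian, innerSL_apply_norm, hx] at h
  simpa [innerSL_apply_apply, real_inner_comm] using h

/-- Anti-concentration: the standard Gaussian density is at most `1 / √(2 π) ≤ 1 / 2`. -/
lemma stdGaussian_abs_inner_le {d : ℕ} {x : Vec d} (hx : ‖x‖ = 1) {R : ℝ} (hR : 0 ≤ R) :
    (stdGaussian (Vec d)).real {w | |inner ℝ w x| ≤ R} ≤ R := by
  have h1 : {w : Vec d | |inner ℝ w x| ≤ R} = (fun w => inner ℝ w x) ⁻¹' Set.Icc (-R) R := by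
    ext w; simp [abs_le]
  have h2 : gaussianReal 0 1 (Set.Icc (-R) R) ≤ ENNReal.ofReal R := by
    rw [gaussianReal_apply 0 one_ne_zero]
    calc ∫⁻ t in Set.Icc (-R) R, gaussianPDF 0 1 t
        ≤ ∫⁻ t in Set.Icc (-R) R, ENNReal.ofReal (1 / 2) := by
          refine lintegral_mono fun t => ENNReal.ofReal_le_ofReal ?_
          simp only [gaussianPDFReal, NNReal.coe_one, mul_one, sub_zero]
          have h3 : Real.exp (-t ^ 2 / 2) ≤ 1 := Real.exp_le_one_iff.2 (by nlinarith [sq_nonneg t])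
          have h4 : (2 : ℝ) ≤ √(2 * Real.pi) :=
            Real.le_sqrt_of_sq_le (by nlinarith [Real.pi_gt_three])
          have h5 : (√(2 * Real.pi))⁻¹ ≤ 1 / 2 := by
            rw [one_div]; exact inv_anti₀ two_pos h4
          calc _ ≤ 1 / 2 * 1 := mul_le_mul h5 h3 (Real.exp_pos _).le (by norm_num)
            _ = _ := mul_one _
      _ = ENNReal.ofReal R := by
          rw [setLIntegral_const, Real.volume_Icc, ← ENNReal.ofReal_mul (by norm_num)]
          congr 1; ring
  rw [Measure.real, h1, ← Measure.map_apply (by fun_prop) measurableSet_Icc,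
    map_inner_stdGaussian hx]
  exact ENNReal.toReal_le_of_le_ofReal hR h2

instance : IsProbabilityMeasure signMeasure := ⟨by
  simp only [signMeasure, Measure.smul_apply, Measure.add_apply, measure_univ, smul_eq_mul]
  rw [one_add_one_eq_two]
  exact ENNReal.inv_mul_cancel two_ne_zero ENNReal.ofNat_ne_top⟩

instance (m d : ℕ) : IsProbabilityMeasure (initMeasure m d) := by
  unfold initMeasure; infer_instance

lemma ae_signMeasure : ∀ᵐ t ∂signMeasure, |t| = 1 := by
  refine Measure.ae_smul_measure ?_ _
  rw [ae_add_measure_iff]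
  have hm : MeasurableSet {t : ℝ | |t| = 1} := measurableSet_eq_fun (by fun_prop) (by fun_prop)
  constructor
  · rw [ae_dirac_iff hm]; simp
  · rw [ae_dirac_iff hm]; simp

lemma integral_signMeasure (f : ℝ → ℝ) :
    ∫ t, f t ∂signMeasure = (f (-1) + f 1) / 2 := by
  have hi : ∀ t : ℝ, Integrable f (Measure.dirac t) := fun t =>
    integrable_dirac (by finiteness)
  rw [signMeasure, integral_smul_measure, integral_add_measure (hi _) (hi _), integral_dirac,
    integral_dirac]
  simp; ring

lemma variance_const_mul_signMeasure (c : ℝ) : Var[fun t => c * t; signMeasure] = c ^ 2 := by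
  rw [variance_const_mul, variance_eq_integral (by fun_prop), integral_signMeasure,
    integral_signMeasure]
  norm_num

/-- Independent signs: the second moment of `∑ z_r a_r` is `∑ z_r ^ 2`. -/
lemma integral_sq_sum_signs {m : ℕ} (z : Fin m → ℝ) :
    ∫ a, (∑ r, a r * z r) ^ 2 ∂(Measure.pi fun _ : Fin m => signMeasure) = ∑ r, z r ^ 2 := by
  have hL : ∀ r, MemLp (fun t => z r * t) 2 signMeasure := fun r =>
    MemLp.of_bound (by fun_prop) |z r| (by
      filter_upwards [ae_signMeasure] with t ht
      rw [norm_mul, Real.norm_eq_abs, Real.norm_eq_abs, ht, mul_one])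
  have hmp := fun r => measurePreserving_eval (fun _ : Fin m => signMeasure) r
  have hi : ∀ r, Integrable (fun a : Fin m → ℝ => z r * a r)
      (Measure.pi fun _ : Fin m => signMeasure) := fun r =>
    (hmp r).integrable_comp_of_integrable ((hL r).integrable one_le_two)
  have hm : ∫ a, (∑ r, z r * a r) ∂(Measure.pi fun _ : Fin m => signMeasure) = 0 := by
    rw [integral_finsetSum _ fun r _ => hi r]
    refine Finset.sum_eq_zero fun r _ => ?_
    have := integral_comp_eval (μ := fun _ : Fin m => signMeasure) (i := r)
      (f := fun t => z r * t) (by fun_prop)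
    rw [this, integral_signMeasure]; ring
  have h := variance_sum_pi (μ := fun _ : Fin m => signMeasure) (X := fun r t => z r * t) hL
  simp only [variance_const_mul_signMeasure] at h
  rw [← h, variance_of_integral_eq_zero]
  · refine integral_congr_ae (ae_of_all _ fun a => ?_)
    simp [Finset.sum_apply, mul_comm]
  · exact Measurable.aemeasurable (by fun_prop)
  · rw [← hm]
    refine integral_congr_ae (ae_of_all _ fun a => ?_)
    simp [Finset.sum_apply]

lemma ae_initMeasure_signs (m d : ℕ) : ∀ᵐ ω ∂(initMeasure m d), ∀ r, |ω.2 r| = 1 := by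
  rw [ae_all_iff]
  intro r
  have h1 : ∀ᵐ a ∂(Measure.pi fun _ : Fin m => signMeasure), |a r| = 1 :=
    (measurePreserving_eval (fun _ : Fin m => signMeasure) r).quasiMeasurePreserving.ae
      ae_signMeasure
  exact Measure.quasiMeasurePreserving_snd.ae h1

lemma measurable_activation {d : ℕ} (x : Vec d) : Measurable fun w => activation w x := by
  unfold activation
  exact Measurable.ite (measurableSet_le (by fun_prop) (by fun_prop)) (by fun_prop) (by fun_prop)

lemma memLp_inner_stdGaussian {d : ℕ} (x : Vec d) :
    MemLp (fun w => inner ℝ w x) 2 (stdGaussian (Vec d)) := by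
  have h := IsGaussian.memLp_dual (stdGaussian (Vec d)) (innerSL ℝ x) 2 (by simp)
  simpa [innerSL_apply_apply, real_inner_comm] using h

lemma integral_sq_relu_le {d : ℕ} {x : Vec d} (hx : ‖x‖ = 1) :
    ∫ w, max (inner ℝ w x) 0 ^ 2 ∂(stdGaussian (Vec d)) ≤ 1 := by
  have h1 : ∫ w, (inner ℝ w x) ^ 2 ∂(stdGaussian (Vec d)) = 1 := by
    have h := variance_dual_stdGaussian (E := Vec d) (innerSL ℝ x)
    rw [variance_of_integral_eq_zero (by fun_prop) (integral_strongDual_stdGaussian _),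
      innerSL_apply_norm, hx, one_pow] at h
    simpa [innerSL_apply_apply, real_inner_comm] using h
  rw [← h1]
  refine integral_mono_of_nonneg (ae_of_all _ fun w => sq_nonneg _)
    (memLp_inner_stdGaussian x).integrable_sq (ae_of_all _ fun w => ?_)
  rcases max_cases (inner ℝ w x) 0 with ⟨e, h⟩ | ⟨e, h⟩
  · simp [e]
  · simp only [e]; nlinarith [sq_nonneg (inner ℝ w x)]

lemma memLp_relu_stdGaussian {d : ℕ} (x : Vec d) :
    MemLp (fun w => max (inner ℝ w x) 0) 2 (stdGaussian (Vec d)) := by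
  refine (memLp_inner_stdGaussian x).of_le (by fun_prop) (ae_of_all _ fun w => ?_)
  rcases max_cases (inner ℝ w x) 0 with ⟨e, h⟩ | ⟨e, h⟩
  · simp [e]
  · simp [e]

lemma memLp_network {d m : ℕ} (x : Vec d) :
    MemLp (fun ω => network ω.1 ω.2 x) 2 (initMeasure m d) := by
  have hW : ∀ r : Fin m, MemLp (fun W : Fin m → Vec d => max (inner ℝ (W r) x) 0) 2
      (Measure.pi fun _ : Fin m => stdGaussian (Vec d)) := fun r =>
    (memLp_relu_stdGaussian x).comp_measurePreserving
      (measurePreserving_eval (fun _ : Fin m => stdGaussian (Vec d)) r)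
  have hterm : ∀ r : Fin m, MemLp (fun ω : (Fin m → Vec d) × (Fin m → ℝ) =>
      ω.2 r * max (inner ℝ (ω.1 r) x) 0) 2 (initMeasure m d) := fun r => by
    have h1 : MemLp (fun ω : (Fin m → Vec d) × (Fin m → ℝ) => max (inner ℝ (ω.1 r) x) 0) 2
        (initMeasure m d) := MemLp.comp_fst (hW r) _
    refine h1.of_le (Measurable.aestronglyMeasurable (by fun_prop)) ?_
    filter_upwards [ae_initMeasure_signs m d] with ω hω
    rw [norm_mul, Real.norm_eq_abs, hω, one_mul]
  exact (memLp_finsetSum Finset.univ fun r _ => hterm r).const_mul (1 / √m)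

/-- The output of the network at initialization has second moment at most `1`. -/
lemma integral_sq_network_le {d m : ℕ} {x : Vec d} (hx : ‖x‖ = 1) :
    ∫ ω, network ω.1 ω.2 x ^ 2 ∂(initMeasure m d) ≤ 1 := by
  have hint := (memLp_network (m := m) x).integrable_sq
  rw [initMeasure, integral_prod _ hint]
  have h1 : ∀ W : Fin m → Vec d,
      ∫ a, network W a x ^ 2 ∂(Measure.pi fun _ : Fin m => signMeasure)
        = (m : ℝ)⁻¹ * ∑ r, max (inner ℝ (W r) x) 0 ^ 2 := by
    intro W
    rw [← integral_sq_sum_signs, ← integral_const_mul]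
    refine integral_congr_ae (ae_of_all _ fun a => ?_)
    simp only [network, mul_pow, one_div, inv_pow, Real.sq_sqrt (Nat.cast_nonneg m)]
  simp only [h1]
  have hmp := fun r => measurePreserving_eval (fun _ : Fin m => stdGaussian (Vec d)) r
  have hsq : ∀ r, Integrable (fun W : Fin m → Vec d => max (inner ℝ (W r) x) 0 ^ 2)
      (Measure.pi fun _ : Fin m => stdGaussian (Vec d)) := fun r =>
    (hmp r).integrable_comp_of_integrable (memLp_relu_stdGaussian x).integrable_sq
  rw [integral_const_mul, integral_finsetSum _ fun r _ =>
    hsq r]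
  have h2 : ∀ r : Fin m, ∫ W, max (inner ℝ (W r) x) 0 ^ 2
      ∂(Measure.pi fun _ : Fin m => stdGaussian (Vec d)) ≤ 1 := fun r => by
    rw [integral_comp_eval (μ := fun _ : Fin m => stdGaussian (Vec d)) (i := r)
      (f := fun w => max (inner ℝ w x) 0 ^ 2) (by fun_prop)]
    exact integral_sq_relu_le hx
  calc _ ≤ (m : ℝ)⁻¹ * ∑ _r : Fin m, 1 :=
        mul_le_mul_of_nonneg_left (Finset.sum_le_sum fun r _ => h2 r) (by positivity)
    _ ≤ 1 := by
        simp only [Finset.sum_const, Finset.card_univ, Fintype.card_fin, nsmul_eq_mul, mul_one]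
        exact inv_mul_le_one

/-- The Gram matrix at initialization is an average of `m` independent copies, with mean
`gramInf`. -/
lemma integral_sq_gramEmp_sub_le {n d m : ℕ} (hm : 0 < m) {x : Fin n → Vec d}
    (hx : ∀ i, ‖x i‖ = 1) (i j : Fin n) :
    MemLp (fun W => gramEmp x W i j - gramInf x i j) 2
        (Measure.pi fun _ : Fin m => stdGaussian (Vec d)) ∧
      ∫ W, (gramEmp x W i j - gramInf x i j) ^ 2
        ∂(Measure.pi fun _ : Fin m => stdGaussian (Vec d)) ≤ (m : ℝ)⁻¹ := by
  set g : Vec d → ℝ := fun w => activation w (x i) * activation w (x j) * inner ℝ (x i) (x j)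
    with hg
  have hgm : Measurable g :=
    ((measurable_activation _).mul (measurable_activation _)).mul_const _
  have hg1 : ∀ w, ‖g w‖ ≤ 1 := fun w => by
    rw [hg, Real.norm_eq_abs, abs_mul, abs_mul, abs_of_nonneg (activation_nonneg _ _),
      abs_of_nonneg (activation_nonneg _ _)]
    have h1 := abs_real_inner_le_norm (x i) (x j)
    rw [hx, hx, mul_one] at h1
    exact mul_le_one₀ (mul_le_one₀ (activation_le_one _ _) (activation_nonneg _ _)
      (activation_le_one _ _)) (abs_nonneg _) h1
  have hgL : MemLp g 2 (stdGaussian (Vec d)) := MemLp.of_bound hgm.aestronglyMeasurable 1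
    (ae_of_all _ hg1)
  have hmp := fun r => measurePreserving_eval (fun _ : Fin m => stdGaussian (Vec d)) r
  have hgL' : ∀ r : Fin m, MemLp (fun W : Fin m → Vec d => g (W r)) 2
      (Measure.pi fun _ : Fin m => stdGaussian (Vec d)) := fun r =>
    hgL.comp_measurePreserving (hmp r)
  have hemp : ∀ W : Fin m → Vec d, gramEmp x W i j = (m : ℝ)⁻¹ * ∑ r, g (W r) := fun W => rfl
  have hinf : gramInf x i j = ∫ w, g w ∂(stdGaussian (Vec d)) := by
    rw [gramInf, Matrix.of_apply]
    refine integral_congr_ae (ae_of_all _ fun w => ?_)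
    simp only [hg, activation]
    split_ifs <;> simp_all
  have hm0 : (m : ℝ) ≠ 0 := by positivity
  have hmean : ∫ W, gramEmp x W i j ∂(Measure.pi fun _ : Fin m => stdGaussian (Vec d))
      = gramInf x i j := by
    simp only [hemp]
    rw [integral_const_mul, integral_finsetSum _ fun r _ => (hgL' r).integrable one_le_two]
    simp only [integral_comp_eval (μ := fun _ : Fin m => stdGaussian (Vec d))
      (f := g) hgm.aestronglyMeasurable]
    rw [hinf]
    simp [hm0]
  have hL : MemLp (fun W : Fin m → Vec d => gramEmp x W i j) 2
      (Measure.pi fun _ : Fin m => stdGaussian (Vec d)) := by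
    simp only [hemp]
    exact (memLp_finsetSum _ fun r _ => hgL' r).const_mul _
  refine ⟨hL.sub (memLp_const _), ?_⟩
  have hvar : Var[g; stdGaussian (Vec d)] ≤ 1 := by
    refine (variance_le_expectation_sq hgm.aestronglyMeasurable).trans ?_
    refine (integral_mono_of_nonneg (g := fun _ => (1 : ℝ)) (ae_of_all _ fun w => ?_)
      (integrable_const _) (ae_of_all _ fun w => ?_)).trans (by simp)
    · simp only [Pi.zero_apply, Pi.pow_apply]; positivity
    · simp only [Pi.pow_apply]
      exact (sq_le_one_iff_abs_le_one _).2 (hg1 w)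
  have hv := variance_eq_integral hL.aestronglyMeasurable.aemeasurable
  rw [hmean] at hv
  rw [← hv]
  simp only [hemp]
  rw [variance_const_mul]
  have hs := variance_sum_pi (μ := fun _ : Fin m => stdGaussian (Vec d)) (X := fun _ => g)
    fun _ => hgL
  have hs' : Var[fun W : Fin m → Vec d => ∑ r, g (W r);
      Measure.pi fun _ : Fin m => stdGaussian (Vec d)] = m * Var[g; stdGaussian (Vec d)] := by
    have e : (∑ r, fun W : Fin m → Vec d => g (W r)) = fun W => ∑ r, g (W r) := by
      ext W; simp
    rw [e] at hs
    rw [hs]; simp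
  rw [hs']
  calc (m : ℝ)⁻¹ ^ 2 * (m * Var[g; stdGaussian (Vec d)]) ≤ (m : ℝ)⁻¹ ^ 2 * (m * 1) := by gcongr
    _ = _ := by field_simp

lemma integral_marginCount_le {n d m : ℕ} {x : Fin n → Vec d} (hx : ∀ i, ‖x i‖ = 1) {R : ℝ}
    (hR : 0 ≤ R) :
    Integrable (fun W => marginCount x W R) (Measure.pi fun _ : Fin m => stdGaussian (Vec d)) ∧
      ∫ W, marginCount x W R ∂(Measure.pi fun _ : Fin m => stdGaussian (Vec d)) ≤ n * m * R := by
  classical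
  set g : Fin n → Vec d → ℝ := fun i w => if |inner ℝ w (x i)| ≤ R then 1 else 0 with hg
  have hset : ∀ i, MeasurableSet {w : Vec d | |inner ℝ w (x i)| ≤ R} := fun i =>
    measurableSet_le (by fun_prop) (by fun_prop)
  have hgm : ∀ i, Measurable (g i) := fun i =>
    Measurable.ite (hset i) measurable_const measurable_const
  have hgi : ∀ i, Integrable (g i) (stdGaussian (Vec d)) := fun i =>
    (MemLp.of_bound (p := 1) (hgm i).aestronglyMeasurable 1 (ae_of_all _ fun w => by
      simp only [hg]; split_ifs <;> simp)).integrable le_rfl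
  have hgR : ∀ i, ∫ w, g i w ∂(stdGaussian (Vec d)) ≤ R := fun i => by
    have e : g i = Set.indicator {w : Vec d | |inner ℝ w (x i)| ≤ R} 1 := by
      ext w; simp [hg, Set.indicator]
    rw [e, integral_indicator_one (hset i)]
    exact stdGaussian_abs_inner_le (hx i) hR
  have hmp := fun r => measurePreserving_eval (fun _ : Fin m => stdGaussian (Vec d)) r
  have hi : ∀ i r, Integrable (fun W : Fin m → Vec d => g i (W r))
      (Measure.pi fun _ : Fin m => stdGaussian (Vec d)) := fun i r =>
    (hmp r).integrable_comp_of_integrable (hgi i)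
  have he : ∀ W : Fin m → Vec d, marginCount x W R = ∑ i, ∑ r, g i (W r) := fun W => rfl
  simp only [he]
  refine ⟨integrable_finsetSum _ fun i _ => integrable_finsetSum _ fun r _ => hi i r, ?_⟩
  rw [integral_finsetSum _ fun i _ => integrable_finsetSum _ fun r _ => hi i r]
  have h1 : ∀ i, ∫ W, ∑ r, g i (W r) ∂(Measure.pi fun _ : Fin m => stdGaussian (Vec d))
      ≤ m * R := fun i => by
    rw [integral_finsetSum _ fun r _ => hi i r]
    simp only [integral_comp_eval (μ := fun _ : Fin m => stdGaussian (Vec d))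
      (f := g i) (hgm i).aestronglyMeasurable]
    rw [Finset.sum_const, Finset.card_univ, Fintype.card_fin, nsmul_eq_mul]
    exact mul_le_mul_of_nonneg_left (hgR i) (Nat.cast_nonneg m)
  refine (Finset.sum_le_sum fun i _ => h1 i).trans_eq ?_
  simp [mul_assoc]

lemma measure_lt_le_of_integral_le {Ω : Type*} [MeasurableSpace Ω] {μ : Measure Ω}
    [IsProbabilityMeasure μ] {f : Ω → ℝ} (hf0 : ∀ ω, 0 ≤ f ω) (hf : Integrable f μ) {c p : ℝ}
    (hc : 0 < c) (h : ∫ ω, f ω ∂μ ≤ c * p) : μ {ω | c < f ω} ≤ ENNReal.ofReal p := by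
  have h1 := mul_meas_ge_le_integral_of_nonneg (ae_of_all _ hf0) hf c
  have h2 : μ.real {ω | c ≤ f ω} ≤ p := le_of_mul_le_mul_left (h1.trans h) hc
  calc μ {ω | c < f ω} ≤ μ {ω | c ≤ f ω} := measure_mono fun ω (hω : c < f ω) => hω.le
    _ = ENNReal.ofReal (μ.real {ω | c ≤ f ω}) := by rw [ofReal_measureReal]
    _ ≤ _ := ENNReal.ofReal_le_ofReal h2

/-- If an event contains, up to the almost sure event that the output weights are signs, every
initialization with small residual, small Gram deviation and few small margins, then it has
probability at least `1 - δ`. -/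
lemma le_initMeasure_of_forall {n d m : ℕ} (hn : 0 < n) (hm : 0 < m) {x : Fin n → Vec d}
    (hx : ∀ i, ‖x i‖ = 1) {y : EuclideanSpace ℝ (Fin n)} {B δ R : ℝ} (hy : ∀ i, |y i| ≤ B)
    (hδ : 0 < δ) (hR : 0 < R) {s : Set ((Fin m → Vec d) × (Fin m → ℝ))}
    (hs : ∀ ω : (Fin m → Vec d) × (Fin m → ℝ), (∀ r, |ω.2 r| = 1) →
      ‖y - predictions x ω.1 ω.2‖ ^ 2 ≤ 6 * n * (B ^ 2 + 1) / δ →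
      ∑ i, ∑ j, (gramEmp x ω.1 i j - gramInf x i j) ^ 2 ≤ 3 * n ^ 2 / (m * δ) →
      marginCount x ω.1 R ≤ 3 * n * m * R / δ → ω ∈ s) :
    ENNReal.ofReal (1 - δ) ≤ initMeasure m d s := by
  have hn' : (0 : ℝ) < n := by exact_mod_cast hn
  have hm' : (0 : ℝ) < m := by exact_mod_cast hm
  have hE1 : initMeasure m d {ω | 6 * n * (B ^ 2 + 1) / δ < ‖y - predictions x ω.1 ω.2‖ ^ 2}
      ≤ ENNReal.ofReal (δ / 3) := by
    have hL : ∀ i, Integrable (fun ω : (Fin m → Vec d) × (Fin m → ℝ) =>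
        (y i - network ω.1 ω.2 (x i)) ^ 2) (initMeasure m d) := fun i =>
      ((memLp_const (y i)).sub (memLp_network (x i))).integrable_sq
    have e : ∀ ω : (Fin m → Vec d) × (Fin m → ℝ), ‖y - predictions x ω.1 ω.2‖ ^ 2
        = ∑ i, (y i - network ω.1 ω.2 (x i)) ^ 2 := fun ω => by
      rw [EuclideanSpace.norm_sq_eq]
      simp [predictions]
    refine measure_lt_le_of_integral_le (fun _ => sq_nonneg _) ?_ (by positivity) ?_
    · simp only [e]
      exact integrable_finsetSum _ fun i _ => hL i
    · simp only [e]
      rw [integral_finsetSum _ fun i _ => hL i]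
      have h1 : ∀ i, ∫ ω, (y i - network ω.1 ω.2 (x i)) ^ 2 ∂(initMeasure m d)
          ≤ 2 * (B ^ 2 + 1) := fun i => by
        have h2 := integral_sq_network_le (m := m) (hx i)
        have h3 : y i ^ 2 ≤ B ^ 2 := sq_le_sq.2 ((hy i).trans (le_abs_self B))
        have hi := (memLp_network (m := m) (x i)).integrable_sq
        calc _ ≤ ∫ ω, (2 * B ^ 2 + 2 * network ω.1 ω.2 (x i) ^ 2) ∂(initMeasure m d) := by
              refine integral_mono (hL i) ((integrable_const _).add (hi.const_mul 2)) fun ω => ?_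
              nlinarith [sq_nonneg (y i + network ω.1 ω.2 (x i))]
          _ = 2 * B ^ 2 + 2 * ∫ ω, network ω.1 ω.2 (x i) ^ 2 ∂(initMeasure m d) := by
              rw [integral_add (integrable_const _) (hi.const_mul 2)]
              simp [integral_const_mul]
          _ ≤ _ := by linarith
      refine (Finset.sum_le_sum fun i _ => h1 i).trans_eq ?_
      simp only [Finset.sum_const, Finset.card_univ, Fintype.card_fin, nsmul_eq_mul]
      field_simp; norm_num
  have hE2 : initMeasure m d {ω | 3 * n ^ 2 / (m * δ)
      < ∑ i, ∑ j, (gramEmp x ω.1 i j - gramInf x i j) ^ 2} ≤ ENNReal.ofReal (δ / 3) := by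
    refine (measurePreserving_fst.measure_preimage_le {W : Fin m → Vec d | 3 * n ^ 2 / (m * δ)
      < ∑ i, ∑ j, (gramEmp x W i j - gramInf x i j) ^ 2}).trans ?_
    have hi := fun i j => (integral_sq_gramEmp_sub_le hm hx i j).1.integrable_sq
    refine measure_lt_le_of_integral_le (fun _ => by positivity)
      (integrable_finsetSum _ fun i _ => integrable_finsetSum _ fun j _ => hi i j)
      (by positivity) ?_
    rw [integral_finsetSum _ fun i _ => integrable_finsetSum _ fun j _ => hi i j]
    simp only [fun i => integral_finsetSum Finset.univ fun j _ => hi i j]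
    refine (Finset.sum_le_sum fun i _ => Finset.sum_le_sum fun j _ =>
      (integral_sq_gramEmp_sub_le hm hx i j).2).trans_eq ?_
    simp only [Finset.sum_const, Finset.card_univ, Fintype.card_fin, nsmul_eq_mul]
    field_simp
  have hE3 : initMeasure m d {ω | 3 * n * m * R / δ < marginCount x ω.1 R}
      ≤ ENNReal.ofReal (δ / 3) := by
    refine (measurePreserving_fst.measure_preimage_le {W : Fin m → Vec d | 3 * n * m * R / δ
      < marginCount x W R}).trans ?_
    obtain ⟨hi, hle⟩ := integral_marginCount_le (m := m) hx hR.le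
    refine measure_lt_le_of_integral_le (fun _ => marginCount_nonneg _ _ _) hi
      (by positivity) (hle.trans_eq ?_)
    field_simp
  have hcompl : initMeasure m d sᶜ ≤ ENNReal.ofReal δ := by
    have hsub : sᶜ ⊆ {ω | ¬ ∀ r, |ω.2 r| = 1} ∪
        ({ω | 6 * n * (B ^ 2 + 1) / δ < ‖y - predictions x ω.1 ω.2‖ ^ 2} ∪
        ({ω | 3 * n ^ 2 / (m * δ) < ∑ i, ∑ j, (gramEmp x ω.1 i j - gramInf x i j) ^ 2} ∪
        {ω | 3 * n * m * R / δ < marginCount x ω.1 R})) := by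
      intro ω hω
      by_contra hcon
      simp only [Set.mem_union, Set.mem_ofPred_eq, not_or, not_not, not_lt] at hcon
      exact hω (hs ω hcon.1 hcon.2.1 hcon.2.2.1 hcon.2.2.2)
    have h0 : initMeasure m d {ω | ¬ ∀ r, |ω.2 r| = 1} = 0 := ae_initMeasure_signs m d
    calc _ ≤ 0 + (ENNReal.ofReal (δ / 3) + (ENNReal.ofReal (δ / 3) + ENNReal.ofReal (δ / 3))) := by
          refine (measure_mono hsub).trans ((measure_union_le _ _).trans (add_le_add h0.le ?_))
          refine (measure_union_le _ _).trans (add_le_add hE1 ?_)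
          exact (measure_union_le _ _).trans (add_le_add hE2 hE3)
      _ = ENNReal.ofReal δ := by
          rw [zero_add, ← ENNReal.ofReal_add (by positivity) (by positivity),
            ← ENNReal.ofReal_add (by positivity) (by positivity)]
          congr 1; ring
  have h1 : (1 : ENNReal) ≤ initMeasure m d s + ENNReal.ofReal δ := by
    calc (1 : ENNReal) = initMeasure m d (s ∪ sᶜ) := by rw [Set.union_compl_self, measure_univ]
      _ ≤ _ := (measure_union_le _ _).trans (by gcongr)
  rw [ENNReal.ofReal_sub _ hδ.le, ENNReal.ofReal_one]
  exact tsub_le_iff_right.2 h1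

/-! ### Comparison of the width and time thresholds -/

/-- The radius `lam * δ / (36 * N ^ 2)` accommodates the movement of the neurons: `P` is the movement
before the step size becomes small, and `2 * ρ / lam` the movement afterwards, both in units of
`√(N / M)`. -/
lemma movement_le_radius {N M lam H δ η α C D P ρ₀ : ℝ} (hN : 1 ≤ N) (hM : 0 < M)
    (hlam : 0 < lam) (hH : lam ≤ H) (hδ : 0 < δ) (hη : 0 < η) (hα : 0 < α) (hC : 1 < C)
    (hD : 0 ≤ D) (hρ₀ : ρ₀ = √(N * D / δ)) (hP : P ≤ 2 * η * (η * C * H) / (α ^ 2 * √N))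
    (hwidth : (259200 * C ^ 2 + 10368 * D) * (N ^ 6 / (lam ^ 4 * δ ^ 3)
      + η ^ 4 / α ^ 4 * (N ^ 4 * H ^ 4 / (lam ^ 4 * δ ^ 2))) ≤ M) :
    √N / √M * (P + 2 * (ρ₀ + 2 * H * P) / lam) ≤ lam * δ / (36 * N ^ 2) := by
  have hN0 : 0 < N := by linarith
  have hH0 : 0 < H := by linarith
  have hsN : 0 < √N := Real.sqrt_pos.2 hN0
  have hsM : 0 < √M := Real.sqrt_pos.2 hM
  set X := 10 * C * η ^ 2 * H ^ 2 / (α ^ 2 * lam) with hX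
  set Y := 2 * √N * ρ₀ / lam with hY
  have hK1 : 0 ≤ N ^ 6 / (lam ^ 4 * δ ^ 3) := by positivity
  have hK2 : 0 ≤ η ^ 4 / α ^ 4 * (N ^ 4 * H ^ 4 / (lam ^ 4 * δ ^ 2)) := by positivity
  have hsum : √N * (P + 2 * (ρ₀ + 2 * H * P) / lam) ≤ X + Y := by
    have h1 : √N * P ≤ 2 * C * η ^ 2 * H / α ^ 2 := by
      calc √N * P ≤ √N * (2 * η * (η * C * H) / (α ^ 2 * √N)) := by gcongr
        _ = _ := by field_simp
    have h2 : 1 + 4 * H / lam ≤ 5 * H / lam := by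
      rw [← sub_nonneg]
      have : 5 * H / lam - (1 + 4 * H / lam) = (H - lam) / lam := by field_simp; ring
      rw [this]; exact div_nonneg (by linarith) hlam.le
    calc √N * (P + 2 * (ρ₀ + 2 * H * P) / lam) = √N * P * (1 + 4 * H / lam) + Y := by
          rw [hY]; field_simp; ring
      _ ≤ 2 * C * η ^ 2 * H / α ^ 2 * (5 * H / lam) + Y := by
          refine add_le_add (mul_le_mul h1 h2 (by positivity) (by positivity)) le_rfl
      _ = X + Y := by rw [hX]; field_simp; ring
  have hX2 : X ^ 2 = 129600 * C ^ 2 * (η ^ 4 / α ^ 4 * (N ^ 4 * H ^ 4 / (lam ^ 4 * δ ^ 2)))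
      * (lam * δ / (36 * N ^ 2)) ^ 2 := by
    rw [hX]; field_simp; norm_num
  have hY2 : Y ^ 2 = 5184 * D * (N ^ 6 / (lam ^ 4 * δ ^ 3)) * (lam * δ / (36 * N ^ 2)) ^ 2 := by
    have : ρ₀ ^ 2 = N * D / δ := by rw [hρ₀]; exact Real.sq_sqrt (by positivity)
    rw [hY, div_pow, mul_pow, mul_pow, Real.sq_sqrt hN0.le, this]; field_simp; ring
  have hR0 : 0 ≤ lam * δ / (36 * N ^ 2) := by positivity
  have hfin : X + Y ≤ √M * (lam * δ / (36 * N ^ 2)) := by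
    refine abs_le_of_sq_le_sq' ?_ (by positivity) |>.2
    rw [mul_pow, Real.sq_sqrt hM.le]
    have h3 : (X + Y) ^ 2 ≤ 2 * X ^ 2 + 2 * Y ^ 2 := by nlinarith [sq_nonneg (X - Y)]
    refine h3.trans (le_trans ?_ (mul_le_mul_of_nonneg_right hwidth (sq_nonneg _)))
    rw [hX2, hY2]
    have h4 := mul_nonneg (mul_nonneg hD hK2) (sq_nonneg (lam * δ / (36 * N ^ 2)))
    have h5 := mul_nonneg (mul_nonneg (sq_nonneg C) hK1) (sq_nonneg (lam * δ / (36 * N ^ 2)))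
    linarith
  rw [div_mul_eq_mul_div, div_le_iff₀ hsM]
  linarith

/-- The width dominates the threshold for the concentration of the Gram matrix. -/
lemma gram_deviation_le {N M lam H δ η α C D : ℝ} (hN : 1 ≤ N) (hM : 0 < M)
    (hlam : 0 < lam) (hlam1 : lam ≤ 1) (hδ : 0 < δ) (hδ1 : δ < 1)
    (hC : 1 < C) (hD : 0 ≤ D)
    (hwidth : (259200 * C ^ 2 + 10368 * D) * (N ^ 6 / (lam ^ 4 * δ ^ 3)
      + η ^ 4 / α ^ 4 * (N ^ 4 * H ^ 4 / (lam ^ 4 * δ ^ 2))) ≤ M) :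
    3 * N ^ 2 / (M * δ) ≤ lam ^ 2 / 16 := by
  have hK2 : 0 ≤ η ^ 4 / α ^ 4 * (N ^ 4 * H ^ 4 / (lam ^ 4 * δ ^ 2)) := by positivity
  have h1 : N ^ 2 / (lam ^ 2 * δ) ≤ N ^ 6 / (lam ^ 4 * δ ^ 3) := by
    have hd : δ ^ 3 ≤ δ := by simpa using pow_le_pow_of_le_one hδ.le hδ1.le (show 1 ≤ 3 by norm_num)
    have hl : lam ^ 4 ≤ lam ^ 2 := pow_le_pow_of_le_one hlam.le hlam1 (by norm_num)
    have hn : N ^ 2 ≤ N ^ 6 := pow_le_pow_right₀ hN (by norm_num)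
    gcongr
  have h0 : 0 ≤ N ^ 2 / (lam ^ 2 * δ) := by positivity
  have h2 : 48 * (N ^ 2 / (lam ^ 2 * δ)) ≤ M := by
    refine le_trans ?_ hwidth
    refine mul_le_mul ?_ (by linarith) h0 (by positivity)
    nlinarith
  rw [div_le_div_iff₀ (by positivity) (by norm_num)]
  have h3 : 48 * (N ^ 2 / (lam ^ 2 * δ)) * (lam ^ 2 * δ) = 48 * N ^ 2 := by field_simp
  nlinarith [mul_le_mul_of_nonneg_right h2 (show 0 ≤ lam ^ 2 * δ by positivity)]

section Time

variable {N lam δ ε D : ℝ}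

/-- `s + t ≤ 1 + s * t` for `s, t ≥ 1`, in the form in which logarithms are absorbed into a
product of logarithmic factors. -/
lemma add_le_mul_mul {c s t : ℝ} (hc : 0 ≤ c) (hs : 1 ≤ s) (ht : 1 ≤ t) :
    c + (s - 1) + t ≤ (c + 1) * (s * t) := by
  nlinarith [mul_nonneg (sub_nonneg.2 hs) (sub_nonneg.2 ht),
    mul_nonneg hc (show 0 ≤ s * t - 1 by nlinarith)]

lemma log_max_one_inv_le : Real.log (max 1 (1 / ε)) ≤ max 1 (Real.log (1 / ε)) := by
  rcases le_total 1 (1 / ε) with h | h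
  · rw [max_eq_right h]; exact le_max_right _ _
  · rw [max_eq_left h]; simp

/-- Logarithm of the initial squared residual relative to the target accuracy. -/
lemma log_initial_le {Λ : ℝ} (hN : 1 ≤ N) (hlam : 0 < lam) (hlam1 : lam ≤ 1) (hδ : 0 < δ)
    (hD : 1 ≤ D)
    (hΛ : Λ = 1 + Real.log N + Real.log (1 / lam) + Real.log (1 / δ)) :
    Real.log (N * D / δ * max 1 (1 / ε)) ≤ D + (Λ - 1) + max 1 (Real.log (1 / ε)) := by
  have h1 : 0 ≤ Real.log (1 / lam) := Real.log_nonneg (by rw [le_div_iff₀ hlam]; linarith)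
  have hm : 0 < max 1 (1 / ε) := lt_max_of_lt_left one_pos
  have h2 : Real.log (N * D / δ) = Real.log N + Real.log D + Real.log (1 / δ) := by
    rw [mul_div_assoc, Real.log_mul (by positivity) (by positivity), div_eq_mul_one_div D,
      Real.log_mul (by positivity) (by positivity), add_assoc]
  rw [Real.log_mul (by positivity) hm.ne', h2]
  linarith [log_max_one_inv_le (ε := ε), Real.log_le_self (show 0 ≤ D by linarith)]

lemma one_le_logFactor_real (hN : 1 ≤ N) (hlam : 0 < lam) (hlam1 : lam ≤ 1) (hδ : 0 < δ)
    (hδ1 : δ < 1) : 1 ≤ 1 + Real.log N + Real.log (1 / lam) + Real.log (1 / δ) := by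
  have h1 : 0 ≤ Real.log (1 / lam) := Real.log_nonneg (by rw [le_div_iff₀ hlam]; linarith)
  have h2 : 0 ≤ Real.log (1 / δ) := Real.log_nonneg (by rw [le_div_iff₀ hδ]; linarith)
  have h3 : 0 ≤ Real.log N := Real.log_nonneg hN
  linarith

/-- The contribution of the initial residual to the limit of the sequence `b`. -/
lemma sqrt_mul_residual_le {η α ρ₀ : ℝ} (hN : 1 ≤ N) (hlam : 0 < lam) (hδ : 0 < δ) (hη : 0 < η)
    (hD : 1 ≤ D) (hρ₀ : ρ₀ = √(N * D / δ)) :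
    2 * (α ^ 2 * √N) * ρ₀ / (η * lam) / (η * lam) ≤
      2 * D * (α ^ 2 * N / (η ^ 2 * lam ^ 2 * √δ)) := by
  have hsD : √D ≤ D := Real.sqrt_le_left (by linarith) |>.2 (by nlinarith)
  have hsδ : 0 < √δ := Real.sqrt_pos.2 hδ
  have e : √N * ρ₀ = N * √D / √δ := by
    rw [hρ₀, Real.sqrt_div (by positivity), Real.sqrt_mul (by linarith), ← mul_div_assoc,
      ← mul_assoc, Real.mul_self_sqrt (by linarith)]
  calc _ = 2 * α ^ 2 * (√N * ρ₀) / (η ^ 2 * lam ^ 2) := by field_simp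
    _ = 2 * √D * (α ^ 2 * N / (η ^ 2 * lam ^ 2 * √δ)) := by rw [e]; field_simp
    _ ≤ _ := by gcongr

/-- Iteration count when the step size is small from the start. -/
lemma time_le_of_small_step {η α b₀ ρ₀ Λ : ℝ} (hN : 1 ≤ N) (hlam : 0 < lam) (hlam1 : lam ≤ 1)
    (hδ : 0 < δ) (hδ1 : δ < 1) (hη : 0 < η) (hb₀ : 0 < b₀) (hD : 1 ≤ D)
    (hε : 0 < ε) (hρ₀ : ρ₀ = √(N * D / δ))
    (hΛ : Λ = 1 + Real.log N + Real.log (1 / lam) + Real.log (1 / δ)) :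
    (b₀ + 2 * (α ^ 2 * √N) * ρ₀ / (η * lam)) / (η * lam) * Real.log (ρ₀ ^ 2 / ε) ≤
      2 * D * (D + 1) * Λ * ((b₀ / (η * lam) + α ^ 2 * N / (η ^ 2 * lam ^ 2 * √δ))
        * max 1 (Real.log (1 / ε))) := by
  have hΛ1 : 1 ≤ Λ := hΛ ▸ one_le_logFactor_real hN hlam hlam1 hδ hδ1
  set L := max 1 (Real.log (1 / ε)) with hL
  have hL1 : 1 ≤ L := le_max_left _ _
  have hb : 0 ≤ b₀ / (η * lam) := by positivity
  have hfac : (b₀ + 2 * (α ^ 2 * √N) * ρ₀ / (η * lam)) / (η * lam) ≤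
      2 * D * (b₀ / (η * lam) + α ^ 2 * N / (η ^ 2 * lam ^ 2 * √δ)) := by
    rw [add_div]
    have := sqrt_mul_residual_le (α := α) hN hlam hδ hη hD hρ₀
    nlinarith
  have hfac0 : 0 ≤ (b₀ + 2 * (α ^ 2 * √N) * ρ₀ / (η * lam)) / (η * lam) := by
    have : 0 ≤ ρ₀ := hρ₀ ▸ Real.sqrt_nonneg _
    positivity
  have hlog : Real.log (ρ₀ ^ 2 / ε) ≤ (D + 1) * (Λ * L) := by
    have hs : ρ₀ ^ 2 = N * D / δ := by rw [hρ₀]; exact Real.sq_sqrt (by positivity)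
    refine le_trans ?_ ((log_initial_le (ε := ε) hN hlam hlam1 hδ hD hΛ).trans
      (add_le_mul_mul (by linarith) hΛ1 hL1))
    rw [hs, div_eq_mul_one_div _ ε]
    refine Real.log_le_log (by positivity) ?_
    gcongr
    exact le_max_right _ _
  calc _ ≤ (b₀ + 2 * (α ^ 2 * √N) * ρ₀ / (η * lam)) / (η * lam) * ((D + 1) * (Λ * L)) :=
        mul_le_mul_of_nonneg_left hlog hfac0
    _ ≤ 2 * D * (b₀ / (η * lam) + α ^ 2 * N / (η ^ 2 * lam ^ 2 * √δ)) * ((D + 1) * (Λ * L)) :=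
        mul_le_mul_of_nonneg_right hfac (by positivity)
    _ = _ := by ring

/-- If `η ≤ α`, the number `Q` of iterations with large step size is polynomially bounded. -/
lemma log_one_add_le_of_le {η α C H Q : ℝ} (hN : 1 ≤ N) (hH0 : 0 < H) (hHN : H ≤ N)
    (hη : 0 < η) (hC : 1 < C) (hε : 0 < ε) (hQ : 0 ≤ Q) (hηα : η ≤ α)
    (hQle : Q ≤ (η * C * H) ^ 2 / (α ^ 2 * √(N * ε))) :
    Real.log (1 + 4 * Q) ≤ 4 * C ^ 2 + 2 * Real.log N + max 1 (Real.log (1 / ε)) := by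
  have hN0 : 0 < N := by linarith
  have hα : 0 < α := hη.trans_le hηα
  have hsε : 0 < √ε := Real.sqrt_pos.2 hε
  have hinv : 1 / √ε ≤ max 1 (1 / ε) := by
    rcases le_total 1 ε with h | h
    · refine le_trans ?_ (le_max_left _ _)
      rw [div_le_one hsε]; exact Real.one_le_sqrt.2 h
    · refine le_trans ?_ (le_max_right _ _)
      refine one_div_le_one_div_of_le hε ?_
      exact Real.le_sqrt_of_sq_le (by nlinarith)
  have hQ2 : Q ≤ C ^ 2 * N ^ 2 * max 1 (1 / ε) := by
    calc Q ≤ (η * C * H) ^ 2 / (α ^ 2 * √(N * ε)) := hQle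
      _ ≤ (α * C * N) ^ 2 / (α ^ 2 * √ε) := by
          have : ε ≤ N * ε := le_mul_of_one_le_left hε.le hN
          gcongr
      _ = C ^ 2 * N ^ 2 * (1 / √ε) := by field_simp
      _ ≤ _ := by gcongr
  have hm1 : 1 ≤ max 1 (1 / ε) := le_max_left _ _
  have h1 : 1 + 4 * Q ≤ (1 + 4 * C ^ 2) * N ^ 2 * max 1 (1 / ε) := by
    have : 1 ≤ N ^ 2 * max 1 (1 / ε) := one_le_mul_of_one_le_of_one_le (one_le_pow₀ hN) hm1
    linarith
  have h2 : Real.log ((1 + 4 * C ^ 2) * N ^ 2 * max 1 (1 / ε))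
      = Real.log (1 + 4 * C ^ 2) + 2 * Real.log N + Real.log (max 1 (1 / ε)) := by
    rw [Real.log_mul (by positivity) (by positivity), Real.log_mul (by positivity)
      (by positivity), Real.log_pow]
    norm_num
  have h3 : Real.log (1 + 4 * C ^ 2) ≤ 4 * C ^ 2 := by
    linarith [Real.log_le_sub_one_of_pos (show 0 < 1 + 4 * C ^ 2 by positivity)]
  have h5 := Real.log_le_log (by positivity) h1
  rw [h2] at h5
  linarith [log_max_one_inv_le (ε := ε)]

/-- If `α ≤ η`, the time scale of the geometric decay is polynomially bounded. -/
lemma decay_time_le_of_le {η α H : ℝ} (hN : 1 ≤ N) (hlam : 0 < lam) (hH0 : 0 < H) (hHN : H ≤ N)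
    (hδ : 0 < δ) (hδ1 : δ < 1) (hη : 0 < η) (hα : 0 < α) (hαη : α ≤ η) :
    α ^ 2 * N / (η ^ 2 * lam ^ 2 * √δ) + (H / lam) ^ 2 ≤ 2 * (N ^ 2 / (lam ^ 2 * δ)) := by
  have hsδ : δ ≤ √δ := Real.le_sqrt_of_sq_le (by nlinarith)
  have hNN : N ≤ N ^ 2 := by nlinarith
  have h1 : α ^ 2 * N / (η ^ 2 * lam ^ 2 * √δ) ≤ N ^ 2 / (lam ^ 2 * δ) := by
    calc _ ≤ η ^ 2 * N ^ 2 / (η ^ 2 * lam ^ 2 * δ) := by gcongr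
      _ = _ := by field_simp
  have h2 : (H / lam) ^ 2 ≤ N ^ 2 / (lam ^ 2 * δ) := by
    rw [div_pow]
    have : lam ^ 2 * δ ≤ lam ^ 2 := mul_le_of_le_one_right (sq_nonneg _) hδ1.le
    gcongr
  linarith

/-- The residual may grow by a factor depending on `η / α` before the step size becomes small, which
the logarithmic factor does not see. The corresponding logarithm `log (1 + 4 Q)` is absorbed by the
number `Q` of iterations spent there, unless `Q` is polynomially bounded. -/
lemma mul_log_one_add_le {η α C H Q A L Λ : ℝ} (hN : 1 ≤ N) (hlam : 0 < lam) (hlam1 : lam ≤ 1)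
    (hH0 : 0 < H) (hHN : H ≤ N)
    (hδ : 0 < δ) (hδ1 : δ < 1) (hη : 0 < η) (hα : 0 < α) (hC : 1 < C) (hε : 0 < ε) (hQ : 0 ≤ Q)
    (hQle : Q ≤ (η * C * H) ^ 2 / (α ^ 2 * √(N * ε)))
    (hA : A = α ^ 2 * N / (η ^ 2 * lam ^ 2 * √δ) + (H / lam) ^ 2)
    (hL : L = max 1 (Real.log (1 / ε)))
    (hΛ : Λ = 1 + Real.log N + Real.log (1 / lam) + Real.log (1 / δ)) :
    A * Real.log (1 + 4 * Q) ≤ 4 * Q + (4 * C ^ 2 + 23) * (A * (Λ * L)) := by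
  have hN0 : 0 < N := by linarith
  have hΛ1 : 1 ≤ Λ := hΛ ▸ one_le_logFactor_real hN hlam hlam1 hδ hδ1
  have hL1 : 1 ≤ L := hL ▸ le_max_left _ _
  have hΛL : 1 ≤ Λ * L := one_le_mul_of_one_le_of_one_le hΛ1 hL1
  have hΛΛL : Λ ≤ Λ * L := le_mul_of_one_le_right (by linarith) hL1
  have hLΛL : L ≤ Λ * L := le_mul_of_one_le_left (by linarith) hΛ1
  have hA0 : 0 ≤ A := by rw [hA]; positivity
  have hlN : 0 ≤ Real.log N := Real.log_nonneg hN
  have hll : 0 ≤ Real.log (1 / lam) := Real.log_nonneg (by rw [le_div_iff₀ hlam]; linarith)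
  have hlδ : 0 ≤ Real.log (1 / δ) := Real.log_nonneg (by rw [le_div_iff₀ hδ]; linarith)
  have hCΛL : 4 * C ^ 2 ≤ 4 * C ^ 2 * (Λ * L) := le_mul_of_one_le_right (by positivity) hΛL
  have hC2 : 0 ≤ 4 * C ^ 2 := by positivity
  -- it suffices to bound the logarithm itself
  have hsuff : Real.log (1 + 4 * Q) ≤ (4 * C ^ 2 + 23) * (Λ * L) →
      A * Real.log (1 + 4 * Q) ≤ 4 * Q + (4 * C ^ 2 + 23) * (A * (Λ * L)) := fun h => by
    calc _ ≤ A * ((4 * C ^ 2 + 23) * (Λ * L)) := mul_le_mul_of_nonneg_left h hA0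
      _ = (4 * C ^ 2 + 23) * (A * (Λ * L)) := by ring
      _ ≤ _ := le_add_of_nonneg_left (by positivity)
  rcases le_total η α with hηα | hηα
  · apply hsuff
    have := log_one_add_le_of_le hN hH0 hHN hη hC hε hQ hηα hQle
    rw [← hL] at this
    linarith
  · have hAG := decay_time_le_of_le hN hlam hH0 hHN hδ hδ1 hη hα hηα
    rw [← hA] at hAG
    rcases le_total Q (A ^ 2) with hQA | hQA
    · apply hsuff
      have hG1 : 1 ≤ N ^ 2 / (lam ^ 2 * δ) := by
        rw [le_div_iff₀ (by positivity), one_mul]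
        exact (mul_le_one₀ (pow_le_one₀ hlam.le hlam1) hδ.le hδ1.le).trans (one_le_pow₀ hN)
      have e : Real.log (N ^ 2 / (lam ^ 2 * δ))
          = 2 * Real.log N + 2 * Real.log (1 / lam) + Real.log (1 / δ) := by
        have e1 : N ^ 2 / (lam ^ 2 * δ) = N ^ 2 * (1 / lam) ^ 2 * (1 / δ) := by field_simp
        rw [e1, Real.log_mul (by positivity) (by positivity), Real.log_mul (by positivity)
          (by positivity), Real.log_pow, Real.log_pow]
        push_cast; ring
      generalize N ^ 2 / (lam ^ 2 * δ) = G at hAG hG1 e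
      have h1 : 1 + 4 * Q ≤ 17 * G ^ 2 := by
        have h2 : A ^ 2 ≤ (2 * G) ^ 2 := pow_le_pow_left₀ hA0 hAG 2
        have h3 : 1 ≤ G ^ 2 := one_le_pow₀ hG1
        linarith
      have h5 := Real.log_le_log (by positivity) h1
      rw [Real.log_mul (by norm_num) (by positivity), Real.log_pow, e] at h5
      have h3 : Real.log 17 ≤ 16 := by
        linarith [Real.log_le_sub_one_of_pos (show (0 : ℝ) < 17 by norm_num)]
      push_cast at h5
      linarith
    · have hAQ : A ≤ √Q := Real.le_sqrt_of_sq_le hQA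
      have hlog : Real.log (1 + 4 * Q) ≤ 4 * √Q := by
        have h1 : 1 + 4 * Q ≤ (1 + 2 * √Q) ^ 2 := by
          nlinarith [Real.sq_sqrt hQ, Real.sqrt_nonneg Q]
        have h2 := Real.log_le_log (by positivity) h1
        rw [Real.log_pow] at h2
        have h3 := Real.log_le_sub_one_of_pos (show 0 < 1 + 2 * √Q by positivity)
        push_cast at h2
        linarith
      have h1 : A * Real.log (1 + 4 * Q) ≤ √Q * (4 * √Q) :=
        mul_le_mul hAQ hlog (Real.log_nonneg (by linarith)) (Real.sqrt_nonneg _)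
      have h2 : √Q * (4 * √Q) = 4 * Q := by rw [mul_left_comm, Real.mul_self_sqrt hQ]
      have h3 : 0 ≤ (4 * C ^ 2 + 23) * (A * (Λ * L)) := by positivity
      linarith

/-- Logarithm of the squared residual when the step size becomes small. -/
lemma log_sq_residual_le {Q ρ ρ₀ Λ : ℝ} (hN : 1 ≤ N) (hlam : 0 < lam) (hlam1 : lam ≤ 1)
    (hδ : 0 < δ) (hδ1 : δ < 1) (hD : 1 ≤ D) (hε : 0 < ε) (hρ0 : 0 < ρ) (hQ0 : 0 ≤ Q)
    (hρ₀ : ρ₀ = √(N * D / δ)) (hρ : ρ ≤ ρ₀ + 4 * Q * √ε)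
    (hΛ : Λ = 1 + Real.log N + Real.log (1 / lam) + Real.log (1 / δ)) :
    Real.log (ρ ^ 2 / ε) ≤
      (D + 3) * (Λ * max 1 (Real.log (1 / ε))) + 2 * Real.log (1 + 4 * Q) := by
  have hN0 : 0 < N := by linarith
  have hΛ1 : 1 ≤ Λ := hΛ ▸ one_le_logFactor_real hN hlam hlam1 hδ hδ1
  have hs : ρ₀ ^ 2 = N * D / δ := by rw [hρ₀]; exact Real.sq_sqrt (by positivity)
  have h4 := log_initial_le (ε := ε) hN hlam hlam1 hδ hD hΛ
  have hND : 1 ≤ N * D / δ := by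
    rw [le_div_iff₀ hδ, one_mul]
    exact hδ1.le.trans (one_le_mul_of_one_le_of_one_le hN hD)
  have hU1 : 1 ≤ N * D / δ * max 1 (1 / ε) :=
    one_le_mul_of_one_le_of_one_le hND (le_max_left _ _)
  have hu : ρ₀ ^ 2 / ε ≤ N * D / δ * max 1 (1 / ε) := by
    rw [hs, div_eq_mul_one_div _ ε]
    gcongr
    exact le_max_right _ _
  generalize N * D / δ * max 1 (1 / ε) = U at h4 hU1 hu
  have h1 : ρ ^ 2 / ε ≤ 4 * U * (1 + 4 * Q) ^ 2 := by
    have h2 : ρ ^ 2 ≤ 2 * ρ₀ ^ 2 + 32 * Q ^ 2 * ε := by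
      have h4 : ρ ^ 2 ≤ (ρ₀ + 4 * Q * √ε) ^ 2 := pow_le_pow_left₀ hρ0.le hρ 2
      have h5 : (4 * Q * √ε) ^ 2 = 16 * Q ^ 2 * ε := by
        rw [mul_pow, mul_pow, Real.sq_sqrt hε.le]; ring
      have h6 := add_sq_le (a := ρ₀) (b := 4 * Q * √ε)
      linarith
    calc ρ ^ 2 / ε ≤ (2 * ρ₀ ^ 2 + 32 * Q ^ 2 * ε) / ε := by gcongr
      _ = 2 * (ρ₀ ^ 2 / ε) + 32 * Q ^ 2 := by field_simp
      _ ≤ 2 * U + 32 * Q ^ 2 := by linarith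
      _ ≤ 2 * U + 32 * (U * Q ^ 2) + 2 * U + 32 * (U * Q) + 32 * (U * Q ^ 2) := by
          have h7 : Q ^ 2 ≤ U * Q ^ 2 := le_mul_of_one_le_left (sq_nonneg _) hU1
          have h8 : 0 ≤ U * Q := by positivity
          have h9 : 0 ≤ U * Q ^ 2 := by positivity
          linarith
      _ = 4 * U * (1 + 4 * Q) ^ 2 := by ring
  have h2 := Real.log_le_log (by positivity) h1
  rw [Real.log_mul (by positivity) (by positivity), Real.log_mul (by norm_num) (by positivity),
    Real.log_pow] at h2
  have h3 : Real.log 4 ≤ 2 := by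
    have h5 : Real.log (2 ^ 2 : ℝ) = 2 * Real.log 2 := by rw [Real.log_pow]; norm_num
    have h6 : (2 : ℝ) ^ 2 = 4 := by norm_num
    rw [← h6, h5]
    linarith [Real.log_le_sub_one_of_pos (show (0 : ℝ) < 2 by norm_num)]
  have h5 := add_le_mul_mul (c := D + 2) (by linarith) hΛ1 (le_max_left 1 (Real.log (1 / ε)))
  push_cast at h2
  linarith

/-- Iteration count when the step size is large at the start: `Q` iterations until the step size is
small, followed by geometric decay. -/
lemma time_le_of_large_step {η α b₀ bT C H Q A P ρ₀ ρ Λ : ℝ} (hN : 1 ≤ N) (hlam : 0 < lam)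
    (hlam1 : lam ≤ 1) (hH : lam ≤ H) (hHN : H ≤ N) (hδ : 0 < δ) (hδ1 : δ < 1) (hη : 0 < η)
    (hα : 0 < α) (hb₀ : 0 < b₀) (hbT : b₀ ≤ bT) (hbT' : bT ≤ η * C * H)
    (hC : 1 < C) (hD : 1 ≤ D) (hε : 0 < ε) (hρ₀ : ρ₀ = √(N * D / δ))
    (hP : P = 2 * η * (bT - b₀) / (α ^ 2 * √N)) (hρ : ρ = ρ₀ + 2 * H * P)
    (hQ : Q = ((η * C * H) ^ 2 - b₀ ^ 2) / (α ^ 2 * √(N * ε)))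
    (hA : A = α ^ 2 * N / (η ^ 2 * lam ^ 2 * √δ) + (H / lam) ^ 2)
    (hΛ : Λ = 1 + Real.log N + Real.log (1 / lam) + Real.log (1 / δ)) :
    Q + (bT + 2 * (α ^ 2 * √N) * ρ / (η * lam)) / (η * lam) * Real.log (ρ ^ 2 / ε) ≤
      (1 + 8 * (9 * C + 2 * D) + (9 * C + 2 * D) * (D + 3 + 2 * (4 * C ^ 2 + 23))) * Λ *
        (Q + A * max 1 (Real.log (1 / ε))) := by
  have hN0 : 0 < N := by linarith
  have hH0 : 0 < H := by linarith
  have hsN : 0 < √N := Real.sqrt_pos.2 hN0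
  have hsε : 0 < √ε := Real.sqrt_pos.2 hε
  have hΛ1 : 1 ≤ Λ := hΛ ▸ one_le_logFactor_real hN hlam hlam1 hδ hδ1
  set L := max 1 (Real.log (1 / ε)) with hL
  have hL1 : 1 ≤ L := le_max_left _ _
  have hA0 : 0 ≤ A := by rw [hA]; positivity
  have hb0C : b₀ ≤ η * C * H := hbT.trans hbT'
  have hD0 : 0 ≤ (η * C * H) ^ 2 - b₀ ^ 2 := by nlinarith
  have hQ0 : 0 ≤ Q := by rw [hQ]; positivity
  have hρ₀0 : 0 < ρ₀ := by rw [hρ₀]; exact Real.sqrt_pos.2 (by positivity)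
  have hP0 : 0 ≤ P := by
    rw [hP]; exact div_nonneg (mul_nonneg (by positivity) (by linarith)) (by positivity)
  have hρ0 : 0 < ρ := by rw [hρ]; positivity
  have hηH : η * H * (bT - b₀) ≤ η * C * H * (η * C * H - b₀) := by
    have : η * H ≤ η * C * H := by nlinarith [mul_pos hη hH0]
    exact mul_le_mul this (by linarith) (by linarith) (by positivity)
  -- growth of the residual before the step size is small
  have hHP : 2 * H * P ≤ 4 * Q * √ε := by
    have e : 4 * Q * √ε = 4 * ((η * C * H) ^ 2 - b₀ ^ 2) / (α ^ 2 * √N) := by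
      rw [hQ, Real.sqrt_mul hN0.le]; field_simp
    rw [e, hP, ← mul_div_assoc]
    refine div_le_div_of_nonneg_right ?_ (by positivity)
    nlinarith [mul_nonneg hb₀.le (sub_nonneg.2 hb0C)]
  have hfac : (bT + 2 * (α ^ 2 * √N) * ρ / (η * lam)) / (η * lam) ≤ (9 * C + 2 * D) * A := by
    have h1 : bT / (η * lam) ≤ C * (H / lam) ^ 2 := by
      calc bT / (η * lam) ≤ η * C * H / (η * lam) := by gcongr
        _ = C * (H / lam * 1) := by field_simp
        _ ≤ C * (H / lam * (H / lam)) := by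
            have : 1 ≤ H / lam := by rw [le_div_iff₀ hlam]; linarith
            gcongr
        _ = _ := by ring
    have h2 := sqrt_mul_residual_le (α := α) hN hlam hδ hη hD hρ₀
    have h3 : 2 * (α ^ 2 * √N) * (2 * H * P) / (η * lam) / (η * lam) ≤ 8 * C * (H / lam) ^ 2 := by
      calc _ = 8 * H * (bT - b₀) / (η * lam ^ 2) := by rw [hP]; field_simp; ring
        _ ≤ 8 * H * (η * C * H) / (η * lam ^ 2) := by gcongr; linarith
        _ = _ := by field_simp
    have h4 : 0 ≤ α ^ 2 * N / (η ^ 2 * lam ^ 2 * √δ) := by positivity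
    have h5 : 0 ≤ (H / lam) ^ 2 := by positivity
    have e : (bT + 2 * (α ^ 2 * √N) * ρ / (η * lam)) / (η * lam) = bT / (η * lam)
        + 2 * (α ^ 2 * √N) * ρ₀ / (η * lam) / (η * lam)
        + 2 * (α ^ 2 * √N) * (2 * H * P) / (η * lam) / (η * lam) := by rw [hρ]; ring
    rw [e, hA]
    generalize α ^ 2 * N / (η ^ 2 * lam ^ 2 * √δ) = u at h2 h4 ⊢
    generalize (H / lam) ^ 2 = v at h1 h3 h5 ⊢
    have h6 : 0 ≤ C * u := mul_nonneg (by linarith) h4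
    have h7 : 0 ≤ D * v := mul_nonneg (by linarith) h5
    linarith
  have hfac0 : 0 ≤ (bT + 2 * (α ^ 2 * √N) * ρ / (η * lam)) / (η * lam) := by
    have : 0 ≤ bT := by linarith
    positivity
  have hl4 : 0 ≤ Real.log (1 + 4 * Q) := Real.log_nonneg (by linarith)
  have hlog := log_sq_residual_le hN hlam hlam1 hδ hδ1 hD hε hρ0 hQ0 hρ₀
    (show ρ ≤ ρ₀ + 4 * Q * √ε by rw [hρ]; linarith) hΛ
  have hmul := mul_log_one_add_le hN hlam hlam1 hH0 hHN hδ hδ1 hη hα hC hε hQ0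
    (by rw [hQ]; gcongr; linarith [sq_nonneg b₀]) hA hL hΛ
  set c := 9 * C + 2 * D with hc
  have hc0 : 0 ≤ c := by rw [hc]; linarith
  calc Q + (bT + 2 * (α ^ 2 * √N) * ρ / (η * lam)) / (η * lam) * Real.log (ρ ^ 2 / ε)
      ≤ Q + c * A * ((D + 3) * (Λ * L) + 2 * Real.log (1 + 4 * Q)) := by
        refine add_le_add le_rfl ((mul_le_mul_of_nonneg_left hlog hfac0).trans
          (mul_le_mul_of_nonneg_right hfac (by positivity)))
    _ = Q + c * (D + 3) * (A * (Λ * L)) + 2 * c * (A * Real.log (1 + 4 * Q)) := by ring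
    _ ≤ Q + c * (D + 3) * (A * (Λ * L))
        + 2 * c * (4 * Q + (4 * C ^ 2 + 23) * (A * (Λ * L))) := by gcongr
    _ = (1 + 8 * c) * Q + c * (D + 3 + 2 * (4 * C ^ 2 + 23)) * (A * (Λ * L)) := by ring
    _ ≤ (1 + 8 * c) * (Λ * (Q + A * L)) +
        c * (D + 3 + 2 * (4 * C ^ 2 + 23)) * (Λ * (Q + A * L)) := by
        have h1 : Q ≤ Λ * (Q + A * L) :=
          (le_add_of_nonneg_right (by positivity)).trans
            (le_mul_of_one_le_left (by positivity) hΛ1)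
        have h2 : A * (Λ * L) ≤ Λ * (Q + A * L) := by
          rw [mul_left_comm]
          exact mul_le_mul_of_nonneg_left (le_add_of_nonneg_left hQ0) (by linarith)
        gcongr
    _ = _ := by ring

end Time

/-! ### Success with high probability -/

/-- While the squared residual exceeds `ε`, the squared sequence `b` grows linearly. -/
lemma iterates_snd_sq_ge {n m d : ℕ} {x : Fin n → Vec d} {y : EuclideanSpace ℝ (Fin n)}
    {a : Fin m → ℝ} {b₀ η α ε : ℝ} {W₀ : Fin m → Vec d} {k : ℕ}
    (h : ∀ t < k, ε ≤ residual x y a b₀ η α W₀ t ^ 2) :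
    b₀ ^ 2 + k * (α ^ 2 * √(n * ε)) ≤ (iterates x y a b₀ η α W₀ k).2 ^ 2 := by
  induction k with
  | zero => simp [iterates]
  | succ k ih =>
    rw [iterates_snd_sq]
    have h1 := ih fun t ht => h t (by omega)
    have h2 : √ε ≤ residual x y a b₀ η α W₀ k :=
      Real.sqrt_le_left (norm_nonneg _) |>.2 (h k (by omega))
    have h3 : α ^ 2 * √(n * ε) ≤ α ^ 2 * √n * residual x y a b₀ η α W₀ k := by
      rw [Real.sqrt_mul (Nat.cast_nonneg n), ← mul_assoc]
      gcongr
    push_cast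
    linarith

lemma le_iterates_snd {n m d : ℕ} (x : Fin n → Vec d) (y : EuclideanSpace ℝ (Fin n))
    (a : Fin m → ℝ) {b₀ : ℝ} (η α : ℝ) (W₀ : Fin m → Vec d) (hb₀ : 0 < b₀) (k : ℕ) :
    b₀ ≤ (iterates x y a b₀ η α W₀ k).2 := by
  induction k with
  | zero => exact le_rfl
  | succ k ih =>
    refine ih.trans ((sq_le_sq₀ (iterates_snd_pos x y a b₀ η α W₀ hb₀ k).le
      (iterates_snd_pos x y a b₀ η α W₀ hb₀ (k + 1)).le).1 ?_)
    rw [iterates_snd_sq]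
    exact le_add_of_nonneg_right (mul_nonneg (by positivity) (norm_nonneg _))

/-- With a large step size at the start, the residual becomes small on every favourable
initialization: the step size is at most `1 / (C ‖H‖)` after finitely many steps. -/
lemma exists_le_residual_sq_le_of_large_step {n m d : ℕ} {x : Fin n → Vec d}
    {y : EuclideanSpace ℝ (Fin n)} {a : Fin m → ℝ} {W₀ : Fin m → Vec d}
    {b₀ η α ε δ C D lam H ρ₀ : ℝ} {T : ℕ} (hx : ∀ i, ‖x i‖ = 1) (ha : ∀ r, |a r| = 1)
    (hb₀ : 0 < b₀) (hη : 0 < η) (hα : 0 < α) (hε : 0 < ε) (hδ : 0 < δ) (hδ1 : δ < 1)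
    (hC : 1 < C) (hD : 1 ≤ D) (hm : 0 < m)
    (hlam : lam = minEigenvalue (gramInf x)) (hlam0 : 0 < lam)
    (hH : H = maxEigenvalue (gramInf x))
    (hgram : ∑ i, ∑ j, (gramEmp x W₀ i j - gramInf x i j) ^ 2 ≤ lam ^ 2 / 16)
    (hmargin : 2 * n / m * marginCount x W₀ (lam * δ / (36 * n ^ 2)) ≤ lam / 4)
    (hρ₀ : ρ₀ = √(n * D / δ)) (hres : residual x y a b₀ η α W₀ 0 ≤ ρ₀)
    (hwidth : (259200 * C ^ 2 + 10368 * D) * ((n : ℝ) ^ 6 / (lam ^ 4 * δ ^ 3)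
      + η ^ 4 / α ^ 4 * ((n : ℝ) ^ 4 * H ^ 4 / (lam ^ 4 * δ ^ 2))) ≤ m)
    (hb : b₀ ≤ η * C * H)
    (hT : (1 + 8 * (9 * C + 2 * D) + (9 * C + 2 * D) * (D + 3 + 2 * (4 * C ^ 2 + 23))) *
      logFactor n lam δ * (((η * C * H) ^ 2 - b₀ ^ 2) / (α ^ 2 * √(n * ε))
        + (α ^ 2 * n / (η ^ 2 * lam ^ 2 * √δ) + (H / lam) ^ 2) * max 1 (Real.log (1 / ε))) ≤ T) :
    ∃ t ≤ T, residual x y a b₀ η α W₀ t ^ 2 ≤ ε := by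
  by_contra! hcon
  have hA := gramInf_isHermitian x
  have hmin : 0 < minEigenvalue (gramInf x) := hlam ▸ hlam0
  have hd := gramInf_diag_le_one hx
  have hN : (1 : ℝ) ≤ n := by exact_mod_cast pos_of_minEigenvalue_pos hmin
  have hlam1 : lam ≤ 1 := hlam ▸ minEigenvalue_le_one hA hd hmin
  have hHn : H ≤ n := hH ▸ maxEigenvalue_le_card hA hd hmin
  have hlamH : lam ≤ H := by rw [hlam, hH]; exact minEigenvalue_le_maxEigenvalue hA hmin
  have hH0 : 0 < H := by linarith
  have hm' : (0 : ℝ) < m := by exact_mod_cast hm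
  have hn0 : (0 : ℝ) < n := by linarith
  set b : ℕ → ℝ := fun k => (iterates x y a b₀ η α W₀ k).2 with hbdef
  have hbpos : ∀ k, 0 < b k := iterates_snd_pos x y a b₀ η α W₀ hb₀
  have hg : 0 < α ^ 2 * √(n * ε) := by positivity
  set Q := ((η * C * H) ^ 2 - b₀ ^ 2) / (α ^ 2 * √(n * ε)) with hQ
  have hQ0 : 0 ≤ Q := div_nonneg (sub_nonneg.2 (pow_le_pow_left₀ hb₀.le hb 2)) hg.le
  have htime : ∀ bT, b₀ ≤ bT → bT ≤ η * C * H → _ := fun bT h1 h2 =>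
    time_le_of_large_step (bT := bT) hN hlam0 hlam1 hlamH hHn hδ hδ1 hη hα hb₀ h1 h2 hC hD hε hρ₀
      rfl rfl hQ rfl rfl
  have hρ₀pos : 0 < ρ₀ := hρ₀ ▸ Real.sqrt_pos.2 (by positivity)
  have hQT : Q ≤ T := by
    refine le_trans ?_ hT
    have hΛ1 : 1 ≤ logFactor n lam δ := one_le_logFactor_real hN hlam0 hlam1 hδ hδ1
    have hX : 0 ≤ (α ^ 2 * n / (η ^ 2 * lam ^ 2 * √δ) + (H / lam) ^ 2) *
        max 1 (Real.log (1 / ε)) := by positivity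
    refine (le_add_of_nonneg_right hX).trans (le_mul_of_one_le_left (add_nonneg hQ0 hX) ?_)
    refine one_le_mul_of_one_le_of_one_le ?_ hΛ1
    have : 0 ≤ 8 * (9 * C + 2 * D) + (9 * C + 2 * D) * (D + 3 + 2 * (4 * C ^ 2 + 23)) := by
      positivity
    linarith
  -- the step size is small after at most `Q` iterations
  have hfloor : η * C * H ≤ b (⌊Q⌋₊ + 1) := by
    have h1 := iterates_snd_sq_ge (x := x) (y := y) (a := a) (b₀ := b₀) (η := η) (α := α)
      (W₀ := W₀) (ε := ε) (k := ⌊Q⌋₊ + 1)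
      fun t ht => (hcon t ((Nat.le_of_lt_succ ht).trans (Nat.floor_le_of_le hQT))).le
    have h2 : Q ≤ ((⌊Q⌋₊ + 1 : ℕ) : ℝ) := by push_cast; exact (Nat.lt_floor_add_one Q).le
    have h3 : Q * (α ^ 2 * √(n * ε)) = (η * C * H) ^ 2 - b₀ ^ 2 := by
      rw [hQ]; exact div_mul_cancel₀ _ hg.ne'
    refine (sq_le_sq₀ (by positivity) (hbpos _).le).1 ?_
    have h4 := mul_le_mul_of_nonneg_right h2 hg.le
    simp only [hbdef]
    linarith
  -- the geometric decay starts at the first iteration with a small step size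
  classical
  have hex : ∃ t, η * C * H ≤ b (t + 1) := ⟨_, hfloor⟩
  set T₀ := Nat.find hex with hT₀
  have hT₀spec : η * C * H ≤ b (T₀ + 1) := Nat.find_spec hex
  have hbT : b T₀ ≤ η * C * H := by
    rcases Nat.eq_zero_or_pos T₀ with h | h
    · rw [h]; exact hb
    · obtain ⟨k, hk⟩ := Nat.exists_eq_succ_of_ne_zero h.ne'
      have := Nat.find_min hex (m := k) (by omega)
      rw [hk]
      exact (not_le.1 this).le
  have hT₀Q : T₀ ≤ ⌊Q⌋₊ := Nat.find_min' hex hfloor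
  have hT₀Q' : (T₀ : ℝ) ≤ Q := (Nat.cast_le.2 hT₀Q).trans (Nat.floor_le hQ0)
  have hT₀T : T₀ ≤ T := hT₀Q.trans (Nat.floor_le_of_le hQT)
  have hbT0 : b₀ ≤ b T₀ := le_iterates_snd x y a η α W₀ hb₀ T₀
  have hP0 : 0 ≤ 2 * η * (b T₀ - b₀) / (α ^ 2 * √n) :=
    div_nonneg (mul_nonneg (by positivity) (by linarith)) (by positivity)
  have hPle : 2 * η * (b T₀ - b₀) / (α ^ 2 * √n) ≤ 2 * η * (η * C * H) / (α ^ 2 * √n) := by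
    gcongr
    linarith
  have hR := movement_le_radius hN hm' hlam0 hlamH hδ hη hα hC (by linarith) hρ₀ hPle hwidth
  have hk := (htime (b T₀) hbT0 hbT).trans hT
  have hstep : η * H ≤ b (T₀ + 1) := by
    refine le_trans ?_ hT₀spec
    rw [mul_right_comm]
    exact le_mul_of_one_le_right (by positivity) hC.le
  refine (hcon T le_rfl).not_ge ?_
  have hconv := exists_residual_sq_le (x := x) (y := y) (a := a) (W₀ := W₀) (T₀ := T₀)
    (k := T - T₀) (ρ₀ := ρ₀) hx ha hb₀ hη hα hε hmin (hlam ▸ hgram) (hlam ▸ hmargin) hres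
    (show 0 < ρ₀ + 2 * H * (2 * η * (b T₀ - b₀) / (α ^ 2 * √n)) by positivity)
    (hH ▸ hstep) le_rfl (by rw [hH]) (by rw [← hlam]; exact hR)
    (by
      rw [← hlam, Nat.cast_sub hT₀T]
      simp only [hbdef] at hk ⊢
      linarith)
  rwa [Nat.add_sub_cancel' hT₀T] at hconv

/-- With a small step size from the start, the residual becomes small on every favourable
initialization. -/
lemma exists_le_residual_sq_le_of_small_step {n m d : ℕ} {x : Fin n → Vec d}
    {y : EuclideanSpace ℝ (Fin n)} {a : Fin m → ℝ} {W₀ : Fin m → Vec d}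
    {b₀ η α ε δ C D lam H ρ₀ : ℝ} {T : ℕ} (hx : ∀ i, ‖x i‖ = 1) (ha : ∀ r, |a r| = 1)
    (hb₀ : 0 < b₀) (hη : 0 < η) (hα : 0 < α) (hε : 0 < ε) (hδ : 0 < δ) (hδ1 : δ < 1)
    (hC : 1 < C) (hD : 1 ≤ D) (hm : 0 < m)
    (hlam : lam = minEigenvalue (gramInf x)) (hlam0 : 0 < lam)
    (hH : H = maxEigenvalue (gramInf x))
    (hgram : ∑ i, ∑ j, (gramEmp x W₀ i j - gramInf x i j) ^ 2 ≤ lam ^ 2 / 16)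
    (hmargin : 2 * n / m * marginCount x W₀ (lam * δ / (36 * n ^ 2)) ≤ lam / 4)
    (hρ₀ : ρ₀ = √(n * D / δ)) (hres : residual x y a b₀ η α W₀ 0 ≤ ρ₀)
    (hwidth : (259200 * C ^ 2 + 10368 * D) * ((n : ℝ) ^ 6 / (lam ^ 4 * δ ^ 3)
      + η ^ 4 / α ^ 4 * ((n : ℝ) ^ 4 * H ^ 4 / (lam ^ 4 * δ ^ 2))) ≤ m)
    (hb : C * H ≤ b₀ / η)
    (hT : 2 * D * (D + 1) * logFactor n lam δ *
      ((b₀ / (η * lam) + α ^ 2 * n / (η ^ 2 * lam ^ 2 * √δ)) * max 1 (Real.log (1 / ε))) ≤ T) :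
    ∃ t ≤ T, residual x y a b₀ η α W₀ t ^ 2 ≤ ε := by
  refine ⟨T, le_rfl, ?_⟩
  have hA := gramInf_isHermitian x
  have hmin : 0 < minEigenvalue (gramInf x) := hlam ▸ hlam0
  have hd := gramInf_diag_le_one hx
  have hN : (1 : ℝ) ≤ n := by exact_mod_cast pos_of_minEigenvalue_pos hmin
  have hlam1 : lam ≤ 1 := hlam ▸ minEigenvalue_le_one hA hd hmin
  have hlamH : lam ≤ H := by rw [hlam, hH]; exact minEigenvalue_le_maxEigenvalue hA hmin
  have hH0 : 0 < H := by linarith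
  have hm' : (0 : ℝ) < m := by exact_mod_cast hm
  have hn0 : (0 : ℝ) < n := by linarith
  have hρ₀pos : 0 < ρ₀ := hρ₀ ▸ Real.sqrt_pos.2 (by positivity)
  have hP : (0 : ℝ) ≤ 2 * η * (η * C * H) / (α ^ 2 * √n) := by positivity
  have hR := movement_le_radius hN hm' hlam0 hlamH hδ hη hα hC (by linarith) hρ₀ hP hwidth
  have hk := (time_le_of_small_step (α := α) hN hlam0 hlam1 hδ hδ1 hη hb₀ hD hε hρ₀ rfl).trans hT
  have hstep : η * H ≤ (iterates x y a b₀ η α W₀ 1).2 := by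
    refine le_trans ?_ (le_iterates_snd x y a η α W₀ hb₀ 1)
    rw [le_div_iff₀ hη] at hb
    refine le_trans ?_ hb
    rw [mul_comm η]
    exact mul_le_mul_of_nonneg_right (le_mul_of_one_le_left hH0.le hC.le) hη.le
  have hconv := exists_residual_sq_le (x := x) (y := y) (a := a) (W₀ := W₀) (T₀ := 0) (P := 0)
    (k := T) (ρ₀ := ρ₀) hx ha hb₀ hη hα hε hmin (hlam ▸ hgram) (hlam ▸ hmargin) hres hρ₀pos
    (hH ▸ hstep) (by simp [iterates]) (by simp)
    (by rw [← hlam]; simpa using hR) (by rw [← hlam]; exact hk)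
  rwa [zero_add] at hconv

/-- If AdaLoss succeeds on every favourable initialization, it succeeds with probability at least
`1 - δ`: the width is large enough for favourable initializations to have that probability. -/
lemma le_initMeasure_of_forall_favourable {n m d : ℕ} {x : Fin n → Vec d}
    {y : EuclideanSpace ℝ (Fin n)} {B b₀ η α δ C D lam H : ℝ} (hx : ∀ i, ‖x i‖ = 1)
    (hy : ∀ i, |y i| ≤ B) (hδ : 0 < δ) (hδ1 : δ < 1) (hC : 1 < C) (hD : D = 6 * (B ^ 2 + 1))
    (hm : 0 < m) (hlam : lam = minEigenvalue (gramInf x)) (hlam0 : 0 < lam)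
    (hwidth : (259200 * C ^ 2 + 10368 * D) * ((n : ℝ) ^ 6 / (lam ^ 4 * δ ^ 3)
      + η ^ 4 / α ^ 4 * ((n : ℝ) ^ 4 * H ^ 4 / (lam ^ 4 * δ ^ 2))) ≤ m)
    {s : Set ((Fin m → Vec d) × (Fin m → ℝ))}
    (hs : ∀ ω : (Fin m → Vec d) × (Fin m → ℝ), (∀ r, |ω.2 r| = 1) →
      ∑ i, ∑ j, (gramEmp x ω.1 i j - gramInf x i j) ^ 2 ≤ lam ^ 2 / 16 →
      2 * n / m * marginCount x ω.1 (lam * δ / (36 * n ^ 2)) ≤ lam / 4 →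
      residual x y ω.2 b₀ η α ω.1 0 ≤ √(n * D / δ) → ω ∈ s) :
    ENNReal.ofReal (1 - δ) ≤ initMeasure m d s := by
  have hmin : 0 < minEigenvalue (gramInf x) := hlam ▸ hlam0
  have hn := pos_of_minEigenvalue_pos hmin
  have hN : (1 : ℝ) ≤ n := by exact_mod_cast hn
  have hlam1 : lam ≤ 1 := hlam ▸
    minEigenvalue_le_one (gramInf_isHermitian x) (gramInf_diag_le_one hx) hmin
  have hm' : (0 : ℝ) < m := by exact_mod_cast hm
  have hn0 : (0 : ℝ) < n := by linarith
  have hgram := gram_deviation_le hN hm' hlam0 hlam1 hδ hδ1 hC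
    (by rw [hD]; positivity) hwidth
  refine le_initMeasure_of_forall (R := lam * δ / (36 * n ^ 2)) hn hm hx hy hδ (by positivity)
    fun ω h1 h2 h3 h4 => hs ω h1 (h3.trans hgram) ?_ ?_
  · calc _ ≤ 2 * n / m * (3 * n * m * (lam * δ / (36 * n ^ 2)) / δ) := by gcongr
      _ = lam / 6 := by field_simp; norm_num
      _ ≤ lam / 4 := by linarith
  · refine Real.le_sqrt_of_sq_le (h2.trans_eq ?_)
    rw [hD]; ring

end AdaLoss
end

theorem theorem2 (B C : ℝ) (hC : 1 < C) :
    ∃ (Km KT : ℝ) (p : ℕ), 0 < Km ∧ 0 < KT ∧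
      ∀ (n d m : ℕ) (x : Fin n → AdaLoss.Vec d) (y : EuclideanSpace ℝ (Fin n))
        (lam Hnorm δ ε b₀ η α : ℝ),
        (∀ i, ‖x i‖ = 1) → (∀ i, |y i| ≤ B) →
        lam = AdaLoss.minEigenvalue (AdaLoss.gramInf x) → 0 < lam →
        Hnorm = AdaLoss.maxEigenvalue (AdaLoss.gramInf x) →
        0 < δ → δ < 1 → 0 < ε → 0 < b₀ → 0 < η → 0 < α →
        Km * ((n : ℝ) ^ 6 / (lam ^ 4 * δ ^ 3)
            + η ^ 4 / α ^ 4 * ((n : ℝ) ^ 4 * Hnorm ^ 4 / (lam ^ 4 * δ ^ 2))) ≤ (m : ℝ) →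
        (C * Hnorm ≤ b₀ / η →
          ∀ T : ℕ,
            KT * AdaLoss.logFactor n lam δ ^ p *
              ((b₀ / (η * lam) + α ^ 2 * n / (η ^ 2 * lam ^ 2 * Real.sqrt δ))
                * max 1 (Real.log (1 / ε))) ≤ (T : ℝ) →
            ENNReal.ofReal (1 - δ) ≤
              AdaLoss.initMeasure m d (AdaLoss.successEvent m x y b₀ η α ε T)) ∧
        (b₀ / η ≤ C * Hnorm →
          ∀ T : ℕ,
            KT * AdaLoss.logFactor n lam δ ^ p *
              (((η * C * Hnorm) ^ 2 - b₀ ^ 2) / (α ^ 2 * Real.sqrt (n * ε))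
                + (α ^ 2 * n / (η ^ 2 * lam ^ 2 * Real.sqrt δ) + (Hnorm / lam) ^ 2)
                  * max 1 (Real.log (1 / ε))) ≤ (T : ℝ) →
            ENNReal.ofReal (1 - δ) ≤
              AdaLoss.initMeasure m d (AdaLoss.successEvent m x y b₀ η α ε T)) := by
  set D := 6 * (B ^ 2 + 1) with hD
  have hD1 : 1 ≤ D := by nlinarith [sq_nonneg B]
  set K₁ := 2 * D * (D + 1) with hK₁
  set K₂ := 1 + 8 * (9 * C + 2 * D) + (9 * C + 2 * D) * (D + 3 + 2 * (4 * C ^ 2 + 23)) with hK₂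
  have hK₁0 : 0 < K₁ := by positivity
  have hK₂0 : 0 < K₂ := by positivity
  refine ⟨259200 * C ^ 2 + 10368 * D, K₁ + K₂, 1, by positivity, by positivity, ?_⟩
  intro n d m x y lam H δ ε b₀ η α hx hy hlam hlam0 hH hδ hδ1 hε hb₀ hη hα hwidth
  have hA := AdaLoss.gramInf_isHermitian x
  have hmin : 0 < AdaLoss.minEigenvalue (AdaLoss.gramInf x) := hlam ▸ hlam0
  have hN : (1 : ℝ) ≤ n := by exact_mod_cast AdaLoss.pos_of_minEigenvalue_pos hmin
  have hlam1 : lam ≤ 1 :=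
    hlam ▸ AdaLoss.minEigenvalue_le_one hA (AdaLoss.gramInf_diag_le_one hx) hmin
  have hlamH : lam ≤ H := by
    rw [hlam, hH]; exact AdaLoss.minEigenvalue_le_maxEigenvalue hA hmin
  have hH0 : 0 < H := by linarith
  have hn0 : (0 : ℝ) < n := by linarith
  have hm : 0 < m := by
    have h : (0 : ℝ) < m := lt_of_lt_of_le (by positivity) hwidth
    exact_mod_cast h
  have hΛ : 0 < AdaLoss.logFactor n lam δ :=
    one_pos.trans_le (AdaLoss.one_le_logFactor_real hN hlam0 hlam1 hδ hδ1)
  refine ⟨fun hb T hT => ?_, fun hb T hT => ?_⟩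
  · refine AdaLoss.le_initMeasure_of_forall_favourable (b₀ := b₀) hx hy hδ hδ1 hC hD hm hlam hlam0
      hwidth fun ω h1 h2 h3 h4 => ?_
    refine AdaLoss.exists_le_residual_sq_le_of_small_step hx h1 hb₀ hη hα hε hδ hδ1 hC hD1 hm hlam
      hlam0 hH h2 h3 rfl h4 hwidth hb (le_trans ?_ hT)
    rw [pow_one, ← hK₁]
    gcongr
    linarith
  · have hb' : b₀ ≤ η * C * H := by
      rw [div_le_iff₀ hη] at hb
      linarith
    refine AdaLoss.le_initMeasure_of_forall_favourable (b₀ := b₀) hx hy hδ hδ1 hC hD hm hlam hlam0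
      hwidth fun ω h1 h2 h3 h4 => ?_
    refine AdaLoss.exists_le_residual_sq_le_of_large_step hx h1 hb₀ hη hα hε hδ hδ1 hC hD1 hm hlam
      hlam0 hH h2 h3 rfl h4 hwidth hb' (le_trans ?_ hT)
    have hQ0 : 0 ≤ (η * C * H) ^ 2 - b₀ ^ 2 :=
      sub_nonneg.2 (pow_le_pow_left₀ hb₀.le hb' 2)
    rw [pow_one, ← hK₂]
    gcongr
    linarith
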